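/- Updates are generated in a Poisson process of rate $\lambda>0$ (the interarrival times, including the time of the first arrival, are i.i.d. exponential of rate $\lambda$) and are sent to a monitor over a symbol erasure channel with erasure rate $\delta\in[0,1)$, one symbol per channel use, a channel use being the unit of time. Only one update can be in service, and there is no buffer. With preemption, each update enters service immediately at its generation, and it is discarded if the next update is generated before its service is completed. Under the infinite incremental redundancy (IIR) policy the service time $S$ of an update is the number of channel uses until $k_s\ge 1$ of its symbols have been received unerased; erasures are independent of each other and of the arrivals. Then the service times are i.i.d., independent of the arrivals, and negative binomial: $$\mathbb P(S=m)=\binom{m-1}{k_s-1}(1-\delta)^{k_s}\delta^{\,m-k_s},\qquad m=k_s,k_s+1,\dots$$ Let $u(t)$ be the generation time of the last update received by the monitor by time $t$ (before the first reception, $u(t)=u_0$ for some fixed $u_0\le 0$), and let $\Delta(t)=t-u(t)$ be the instantaneous age. 1. For all i.i.d. service times of this negative binomial law that are independent of the arrivals, in particular for those of the IIR policy, the average age $\lim_{\tau\to\infty}\frac1\tau\int_0^\tau\Delta(t)\,dt$ exists almost surely and equals $$\Delta_{\mathrm{PIIR}}(\lambda)=\frac1\lambda\left(\frac{e^\lambda-\delta}{1-\delta}\right)^{k_s}.$$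 2. The function $\Delta_{\mathrm{PIIR}}$ has a minimum on $(0,\infty)$, attained at exactly one rate $\lambda^*$, and $$\lambda^*\le\frac1{k_s}.$$ 3. The minimum age $\Delta_{\mathrm{PIIR}}^*=\Delta_{\mathrm{PIIR}}(\lambda^*)$ satisfies $$\Delta_{\mathrm{PIIR}}^*\ \ge\ \frac1{\lambda_{\mathrm{IIR}}}\left(1+\frac{\lambda_{\mathrm{IIR}}}{1-\delta}\right)^{k_s},\qquad \lambda_{\mathrm{IIR}}=\frac{1-k_s+\sqrt{(k_s+1)^2-4k_s\delta}}{2k_s}.$$ Here $\lambda_{\mathrm{IIR}}$ approximates $\lambda^*$ in the following sense: $\lambda^*$ satisfies $e^{\lambda^*}(k_s\lambda^*-1)=-\delta$, and $\lambda_{\mathrm{IIR}}$ is the only positive solution of the equation $(1+x)(k_sx-1)=-\delta$ that results when the exponential $e^x$ is replaced by $1+x$. -/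

import Mathlib

open MeasureTheory ProbabilityTheory Filter Topology

noncomputable section

namespace AgeOfInformation

/-! ### Sample paths of the M/G/1/1 queue with preemption

`x 0` is the time of the first arrival, `x (n + 1)` the time between the arrivals of updates `n` and
`n + 1`, and `s n` the service time that update `n` requires. The system is empty at time `0`. -/

/-- The generation (arrival) time of update `n`. -/
def arrivalTime (x : ℕ → ℝ) (n : ℕ) : ℝ := ∑ i ∈ Finset.range (n + 1), x i

/-- With preemption, every update enters service at its arrival and stays there until it is completed
or the next update arrives. So update `n` is delivered to the monitor, at time `arrivalTime x n + s n`,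
iff its service is completed before the next arrival. -/
def IsDelivered (x s : ℕ → ℝ) (n : ℕ) : Prop :=
  arrivalTime x n + s n < arrivalTime x (n + 1)

/-- The generation time `u(t)` of the most recent update that the monitor has received by time `t`.
Here `u₀ ≤ 0` is the generation time of the update that the monitor holds at time `0`. -/
def lastGenerationTime (u₀ : ℝ) (x s : ℕ → ℝ) (t : ℝ) : ℝ :=
  sSup (insert u₀ {u : ℝ | ∃ n : ℕ,
    IsDelivered x s n ∧ arrivalTime x n + s n ≤ t ∧ u = arrivalTime x n})

/-- The instantaneous age `Δ(t) = t - u(t)` at the monitor. -/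
def age (u₀ : ℝ) (x s : ℕ → ℝ) (t : ℝ) : ℝ := t - lastGenerationTime u₀ x s t

/-- `f` has long-run time average `a`: `(1/τ) ∫₀^τ f(t) dt → a` as `τ → ∞`, the integrals being
defined. -/
def HasTimeAverage (f : ℝ → ℝ) (a : ℝ) : Prop :=
  (∀ τ : ℝ, 0 ≤ τ → IntervalIntegrable f volume 0 τ) ∧
    Tendsto (fun τ : ℝ => (1 / τ) * ∫ t in (0 : ℝ)..τ, f t) atTop (𝓝 a)

/-! ### The random inputs -/

/-- The probability that a negative binomial variable with `k` successes and success probability `p`,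
counted as the number of trials up to and including the `k`-th success, equals `m`. -/
def negBinomialProb (k : ℕ) (p : ℝ) (m : ℕ) : ℝ :=
  if k ≤ m then ((m - 1).choose (k - 1) : ℝ) * p ^ k * (1 - p) ^ (m - k) else 0

variable {Ω : Type*} [MeasurableSpace Ω]

/-- The updates arrive in a Poisson process of rate `lam`: the interarrival times are i.i.d.
exponential of rate `lam`. -/
structure IsPoissonArrivals (P : Measure Ω) (lam : ℝ) (X : ℕ → Ω → ℝ) : Prop where
  measurable : ∀ n, Measurable (X n)
  law : ∀ n, P.map (X n) = expMeasure lam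
  indep : iIndepFun X P

/-- The service times `S n` are i.i.d. negative binomial `(k, p)`, and the sequence of service times is
independent of the sequence of interarrival times. -/
structure IsNegBinomialService (P : Measure Ω) (k : ℕ) (p : ℝ) (X : ℕ → Ω → ℝ) (S : ℕ → Ω → ℕ) :
    Prop where
  measurable : ∀ n, Measurable (S n)
  law : ∀ n m, P.real {ω | S n ω = m} = negBinomialProb k p m
  indep : iIndepFun S P
  indep_arrivals : IndepFun (fun ω n => X n ω) (fun ω n => S n ω) P

/-- A symbol erasure channel of erasure rate `δ`: `E n j` tells whether the `j`-th encoded symbol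
(`j = 0, 1, …`) of update `n` is erased; the erasures are i.i.d. of probability `δ` and independent
of the arrivals. -/
structure IsErasureChannel (P : Measure Ω) (δ : ℝ) (X : ℕ → Ω → ℝ) (E : ℕ → ℕ → Ω → Bool) :
    Prop where
  measurable : ∀ n j, Measurable (E n j)
  law : ∀ n j, P.real {ω | E n j ω = true} = δ
  indep : iIndepFun (fun q : ℕ × ℕ => E q.1 q.2) P
  indep_arrivals : IndepFun (fun ω n => X n ω) (fun ω (q : ℕ × ℕ) => E q.1 q.2 ω) P

/-- The service time of an update under infinite incremental redundancy: the number of channel uses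
until `k` unerased symbols are received, one symbol being sent per channel use, which is the unit of
time (`e j = true` iff symbol `j` is erased). -/
def iirServiceTime (k : ℕ) (e : ℕ → Bool) : ℕ :=
  sInf {m : ℕ | k ≤ ((Finset.range m).filter (fun j => e j = false)).card}

/-! ### The closed forms -/

/-- `Δ_PIIR(λ) = (1/λ) ((e^λ - δ) / (1 - δ))^k`. -/
def agePIIR (k : ℕ) (δ lam : ℝ) : ℝ := 1 / lam * ((Real.exp lam - δ) / (1 - δ)) ^ k

/-- `λ_IIR = (1 - k + √((k + 1)² - 4 k δ)) / (2 k)`. -/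
def lamIIR (k : ℕ) (δ : ℝ) : ℝ :=
  (1 - (k : ℝ) + Real.sqrt (((k : ℝ) + 1) ^ 2 - 4 * k * δ)) / (2 * k)

/-- The rate `lam > 0` minimizes `Δ_PIIR` over all positive arrival rates. -/
def IsOptimalRate (k : ℕ) (δ lam : ℝ) : Prop :=
  0 < lam ∧ ∀ r : ℝ, 0 < r → agePIIR k δ lam ≤ agePIIR k δ r

end AgeOfInformation

end

noncomputable section

namespace AgeOfInformation

/-! ### The optimal rate -/

/-! Average age. Let `Z n` be the age just before arrival `n`. Until the next arrival the age is a
line of slope one, lowered by `Z n` once service is completed, so its integral over that interval is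
`Z n * min (s n) (x (n + 1)) + x (n + 1) ^ 2 / 2` (`intervalIntegral_age_step`). Moreover `Z (n + 1)
= x (n + 1) + Z n * 1{update n is not delivered}`. Both the non-delivery indicator and the minimum
depend only on the service time of update `n` and the interarrival time after it, and this pair is
independent of `Z n`. After centring, the products with `Z n` are therefore orthogonal. The `Z n`
are bounded in L² because the recursion contracts (`exists_integral_ageAtArrival_sq_le`), so
normalized sums of these products vanish almost surely along the squares; monotonicity fills the
gaps. With `φ = E exp (-λ S)`, an update is delivered with probability `φ`, the mean of the minimum
is `(1 - φ) / λ`, and the average of `Z` is `1 / (λ φ)`. Dividing the mean integral per interval by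
the mean interval `1 / λ` gives `1 / (λ φ)`, which the negative binomial generating function turns
into `agePIIR`.

IIR. The service time is `m + 1` exactly when `k - 1` of the first `m` symbols and also symbol `m`
are unerased; a binomial count gives the law.

Optimal rate. The derivative of `agePIIR` has the sign of `rateFun`, which is strictly increasing on
`[0, ∞)`, negative at `0` and nonnegative at `1 / k`. At its zero, `e^λ - δ = k λ e^λ` turns the age
into an increasing function of `λ` and `e^λ`. The lower bound follows from `lamIIR ≤ λ` and `1 +
lamIIR ≤ e^λ`. -/

/-- The function `e^x (k x - 1) + δ`, which has the sign of the derivative of `agePIIR`. -/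
def rateFun (k : ℕ) (δ x : ℝ) : ℝ := Real.exp x * ((k : ℝ) * x - 1) + δ

lemma hasDerivAt_rateFun (k : ℕ) (δ x : ℝ) :
    HasDerivAt (rateFun k δ) (Real.exp x * (k * x + k - 1)) x := by
  have h := ((Real.hasDerivAt_exp x).mul
    (((hasDerivAt_id x).const_mul (k : ℝ)).sub_const 1)).add_const δ
  convert! h using 1
  simp only [id]; ring

lemma strictMonoOn_rateFun {k : ℕ} (hk : 1 ≤ k) (δ : ℝ) :
    StrictMonoOn (rateFun k δ) (Set.Ici 0) := by
  have hk' : (1 : ℝ) ≤ k := by exact_mod_cast hk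
  refine strictMonoOn_of_deriv_pos (convex_Ici 0)
    (fun x _ => (hasDerivAt_rateFun k δ x).continuousAt.continuousWithinAt) fun x hx => ?_
  rw [interior_Ici, Set.mem_Ioi] at hx
  rw [(hasDerivAt_rateFun k δ x).deriv]
  have : 0 < (k : ℝ) * x := by positivity
  exact mul_pos (Real.exp_pos x) (by linarith)

lemma exists_rateFun_eq_zero {k : ℕ} (hk : 1 ≤ k) {δ : ℝ} (hδ0 : 0 ≤ δ) (hδ1 : δ < 1) :
    ∃ x : ℝ, 0 < x ∧ x ≤ 1 / k ∧ rateFun k δ x = 0 := by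
  have hk' : (0 : ℝ) < k := by exact_mod_cast hk
  have h0 : rateFun k δ 0 = δ - 1 := by simp [rateFun]; ring
  have h1 : rateFun k δ (1 / k) = δ := by
    unfold rateFun; field_simp; simp
  have hc : ContinuousOn (rateFun k δ) (Set.Icc 0 (1 / k)) :=
    fun x _ => (hasDerivAt_rateFun k δ x).continuousAt.continuousWithinAt
  obtain ⟨x, hx, hx0⟩ := intermediate_value_Icc (by positivity) hc
    (show (0 : ℝ) ∈ Set.Icc _ _ by rw [h0, h1]; constructor <;> linarith)
  refine ⟨x, lt_of_le_of_ne hx.1 ?_, hx.2, hx0⟩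
  rintro rfl
  linarith

lemma exp_sub_pos {δ x : ℝ} (hδ1 : δ < 1) (hx : 0 < x) : 0 < Real.exp x - δ := by
  have := Real.one_lt_exp_iff.2 hx
  linarith

/-- The derivative is factored so that everything except `rateFun` is positive. -/
lemma hasDerivAt_agePIIR {k : ℕ} (hk : 1 ≤ k) {δ x : ℝ} (hδ1 : δ < 1) (hx : 0 < x) :
    HasDerivAt (agePIIR k δ)
      (((Real.exp x - δ) / (1 - δ)) ^ (k - 1) / (x ^ 2 * (1 - δ)) * rateFun k δ x) x := by
  have hd : (1 - δ) ≠ 0 := by linarith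
  have h1 : HasDerivAt (fun y : ℝ => 1 / y) (-1 / x ^ 2) x := by
    simpa [neg_div] using hasDerivAt_inv hx.ne'
  have h2 := (((Real.hasDerivAt_exp x).sub_const δ).div_const (1 - δ)).fun_pow k
  have h := h1.fun_mul h2
  convert! h using 1
  obtain ⟨j, rfl⟩ : ∃ j, k = j + 1 := ⟨k - 1, by omega⟩
  unfold rateFun
  have hxx := hx.ne'
  simp only [Nat.add_sub_cancel, pow_succ]
  field_simp
  ring

lemma strictAntiOn_agePIIR {k : ℕ} (hk : 1 ≤ k) {δ l : ℝ} (hδ1 : δ < 1)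
    (hl : rateFun k δ l = 0) : StrictAntiOn (agePIIR k δ) (Set.Ioc 0 l) := by
  refine strictAntiOn_of_deriv_neg (convex_Ioc 0 l) (fun x hx =>
    (hasDerivAt_agePIIR hk hδ1 hx.1).continuousAt.continuousWithinAt) fun x hx => ?_
  rw [interior_Ioc] at hx
  have hx0 := hx.1
  rw [(hasDerivAt_agePIIR hk hδ1 hx.1).deriv]
  have h1 : rateFun k δ x < 0 := hl ▸ strictMonoOn_rateFun hk δ hx.1.le (hx.1.trans hx.2).le hx.2
  have h2 := exp_sub_pos hδ1 hx0
  have h3 : 0 < 1 - δ := by linarith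
  exact mul_neg_of_pos_of_neg (by positivity) h1

lemma strictMonoOn_agePIIR {k : ℕ} (hk : 1 ≤ k) {δ l : ℝ} (hδ1 : δ < 1) (hl0 : 0 < l)
    (hl : rateFun k δ l = 0) : StrictMonoOn (agePIIR k δ) (Set.Ici l) := by
  refine strictMonoOn_of_deriv_pos (convex_Ici l) (fun x hx =>
    (hasDerivAt_agePIIR hk hδ1 (hl0.trans_le hx)).continuousAt.continuousWithinAt) fun x hx => ?_
  rw [interior_Ici] at hx
  have hx0 : 0 < x := hl0.trans hx
  rw [(hasDerivAt_agePIIR hk hδ1 hx0).deriv]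
  have h1 : 0 < rateFun k δ x := hl ▸ strictMonoOn_rateFun hk δ hl0.le hx0.le hx
  have h2 := exp_sub_pos hδ1 hx0
  have h3 : 0 < 1 - δ := by linarith
  positivity

lemma agePIIR_lt_of_rateFun_eq_zero {k : ℕ} (hk : 1 ≤ k) {δ l r : ℝ} (hδ1 : δ < 1) (hl0 : 0 < l)
    (hl : rateFun k δ l = 0) (hr : 0 < r) (hne : r ≠ l) : agePIIR k δ l < agePIIR k δ r := by
  rcases lt_or_gt_of_ne hne with h | h
  · exact strictAntiOn_agePIIR hk hδ1 hl ⟨hr, h.le⟩ ⟨hl0, le_rfl⟩ h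
  · exact strictMonoOn_agePIIR hk hδ1 hl0 hl (Set.mem_Ici.2 le_rfl) h.le h

lemma isOptimalRate_of_rateFun_eq_zero {k : ℕ} (hk : 1 ≤ k) {δ l : ℝ} (hδ1 : δ < 1) (hl0 : 0 < l)
    (hl : rateFun k δ l = 0) : IsOptimalRate k δ l := by
  refine ⟨hl0, fun r hr => ?_⟩
  by_cases h : r = l
  · rw [h]
  · exact (agePIIR_lt_of_rateFun_eq_zero hk hδ1 hl0 hl hr h).le

lemma IsOptimalRate.eq_of_rateFun_eq_zero {k : ℕ} (hk : 1 ≤ k) {δ l r : ℝ} (hδ1 : δ < 1)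
    (hl0 : 0 < l) (hl : rateFun k δ l = 0) (hr : IsOptimalRate k δ r) : r = l := by
  by_contra h
  exact absurd (hr.2 l hl0) (not_le.2 (agePIIR_lt_of_rateFun_eq_zero hk hδ1 hl0 hl hr.1 h))

theorem existsUnique_isOptimalRate {k : ℕ} (hk : 1 ≤ k) {δ : ℝ} (hδ0 : 0 ≤ δ) (hδ1 : δ < 1) :
    ∃! lam : ℝ, IsOptimalRate k δ lam := by
  obtain ⟨l, hl0, -, hl⟩ := exists_rateFun_eq_zero hk hδ0 hδ1
  exact ⟨l, isOptimalRate_of_rateFun_eq_zero hk hδ1 hl0 hl,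
    fun r hr => hr.eq_of_rateFun_eq_zero hk hδ1 hl0 hl⟩

/-- Multiplying the quadratic by `4 k` completes the square: `(2 k x - 1 + k) ^ 2` equals the
discriminant. Since `δ < 1`, its root exceeds `k - 1`, so exactly one of the two solutions is
positive. -/
theorem lamIIR_iff {k : ℕ} (hk : 1 ≤ k) {δ : ℝ} (hδ1 : δ < 1) (x : ℝ) :
    (0 < x ∧ (1 + x) * ((k : ℝ) * x - 1) = -δ) ↔ x = lamIIR k δ := by
  have hk' : (1 : ℝ) ≤ k := by exact_mod_cast hk
  have hpos : ((k : ℝ) - 1) ^ 2 < ((k : ℝ) + 1) ^ 2 - 4 * k * δ := by nlinarith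
  have hD : 0 ≤ ((k : ℝ) + 1) ^ 2 - 4 * k * δ := (sq_nonneg _).trans hpos.le
  have hs := Real.sq_sqrt hD
  have hs1 : (k : ℝ) - 1 < Real.sqrt (((k : ℝ) + 1) ^ 2 - 4 * k * δ) :=
    Real.lt_sqrt_of_sq_lt hpos
  have hlam : 2 * k * lamIIR k δ = 1 - k + Real.sqrt (((k : ℝ) + 1) ^ 2 - 4 * k * δ) := by
    unfold lamIIR; field_simp
  set s := Real.sqrt (((k : ℝ) + 1) ^ 2 - 4 * k * δ)
  constructor
  · rintro ⟨hx, h⟩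
    have h2 : (2 * k * x - 1 + k - s) * (2 * k * x - 1 + k + s) = 0 := by
      linear_combination 4 * k * h - hs
    rcases mul_eq_zero.1 h2 with h3 | h3
    · have h4 : 2 * k * x = 2 * k * lamIIR k δ := by linarith
      exact mul_left_cancel₀ (by positivity) h4
    · have : 0 < k * x := by positivity
      linarith
  · rintro rfl
    constructor
    · exact pos_of_mul_pos_right (a := 2 * (k : ℝ)) (by linarith) (by positivity)
    · have h5 : 4 * (k : ℝ) * ((1 + lamIIR k δ) * ((k : ℝ) * lamIIR k δ - 1) + δ) = 0 := by
        have : s = 2 * k * lamIIR k δ - 1 + k := by linarith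
        rw [this] at hs
        linear_combination hs
      have := (mul_eq_zero.1 h5).resolve_left (by positivity)
      linarith

theorem IsOptimalRate.bounds {k : ℕ} (hk : 1 ≤ k) {δ : ℝ} (hδ0 : 0 ≤ δ) (hδ1 : δ < 1) {lam : ℝ}
    (h : IsOptimalRate k δ lam) :
    lam ≤ 1 / (k : ℝ) ∧ Real.exp lam * ((k : ℝ) * lam - 1) = -δ ∧
      1 / lamIIR k δ * (1 + lamIIR k δ / (1 - δ)) ^ k ≤ agePIIR k δ lam := by
  obtain ⟨l, hl0, hl1, hl⟩ := exists_rateFun_eq_zero hk hδ0 hδ1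
  obtain rfl := h.eq_of_rateFun_eq_zero hk hδ1 hl0 hl
  have hk' : (1 : ℝ) ≤ k := by exact_mod_cast hk
  have hk0 : (0 : ℝ) < k := by linarith
  have hd : 0 < 1 - δ := by linarith
  have heq : Real.exp lam * ((k : ℝ) * lam - 1) = -δ := by unfold rateFun at hl; linarith
  refine ⟨hl1, heq, ?_⟩
  obtain ⟨hm0, hm⟩ := (lamIIR_iff hk hδ1 (lamIIR k δ)).2 rfl
  set m := lamIIR k δ
  have hexp : 1 + lam ≤ Real.exp lam := by linarith [Real.add_one_le_exp lam]
  have hkl : (k : ℝ) * lam ≤ 1 := by rwa [le_div_iff₀ hk0, mul_comm] at hl1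
  have hml : m ≤ lam := by
    by_contra! hlt
    -- As `k * lam - 1 ≤ 0`, replacing `e ^ lam` by the smaller `1 + lam` can only raise the product
    -- above `-δ`, the value at `m`. But `(1 + x) (k x - 1)` is strictly increasing for `x ≥ 0`, so
    -- `lam < m` is impossible.
    have h1 : (1 + m) * (k * m - 1) ≤ (1 + lam) * (k * lam - 1) := by nlinarith
    have h2 : 0 < k * (m - lam) := mul_pos hk0 (by linarith)
    have h3 : 0 < (k : ℝ) * (m - lam) * (m + lam) := by positivity
    nlinarith
  -- Each defining equation removes `δ` from the numerator. Both sides then take the form `y ^ (k -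
  -- 1) * E ^ k * (K / (1 - δ)) ^ k`, with `E = 1 + m` for `y = m` and `E = e ^ lam` for `y = lam`.
  have e1 : 1 + m / (1 - δ) = k * m * (1 + m) / (1 - δ) := by
    field_simp; linarith
  have e2 : (Real.exp lam - δ) / (1 - δ) = k * lam * Real.exp lam / (1 - δ) := by
    congr 1; linarith
  unfold agePIIR
  rw [e1, e2]
  obtain ⟨j, rfl⟩ : ∃ j, k = j + 1 := ⟨k - 1, by omega⟩
  generalize hK : ((j + 1 : ℕ) : ℝ) = K at *
  have f1 : 1 / m * (K * m * (1 + m) / (1 - δ)) ^ (j + 1) =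
      m ^ j * (1 + m) ^ (j + 1) * (K / (1 - δ)) ^ (j + 1) := by
    have := hm0.ne'
    rw [show K * m * (1 + m) / (1 - δ) = m * ((1 + m) * (K / (1 - δ))) by ring, mul_pow, pow_succ m,
      mul_pow]
    field_simp
  have f2 : 1 / lam * (K * lam * Real.exp lam / (1 - δ)) ^ (j + 1) =
      lam ^ j * Real.exp lam ^ (j + 1) * (K / (1 - δ)) ^ (j + 1) := by
    have := hl0.ne'
    rw [show K * lam * Real.exp lam / (1 - δ) = lam * (Real.exp lam * (K / (1 - δ))) by ring,
      mul_pow, pow_succ lam, mul_pow]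
    field_simp
  rw [f1, f2]
  have : 1 + m ≤ Real.exp lam := by linarith
  gcongr

/-! ### Sample paths -/

lemma arrivalTime_zero (x : ℕ → ℝ) : arrivalTime x 0 = x 0 := by simp [arrivalTime]

lemma arrivalTime_succ (x : ℕ → ℝ) (n : ℕ) :
    arrivalTime x (n + 1) = arrivalTime x n + x (n + 1) := by
  simp [arrivalTime, Finset.sum_range_succ]

lemma isDelivered_iff (x s : ℕ → ℝ) (n : ℕ) : IsDelivered x s n ↔ s n < x (n + 1) := by
  simp [IsDelivered, arrivalTime_succ]

lemma strictMono_arrivalTime {x : ℕ → ℝ} (hx : ∀ i, 0 < x i) : StrictMono (arrivalTime x) :=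
  strictMono_nat_of_lt_succ fun n => by rw [arrivalTime_succ]; linarith [hx (n + 1)]

lemma arrivalTime_pos {x : ℕ → ℝ} (hx : ∀ i, 0 < x i) (n : ℕ) : 0 < arrivalTime x n :=
  Finset.sum_pos (fun i _ => hx i) (by simp)

/-- The age just before the arrival of update `n`. -/
def ageAtArrival (u₀ : ℝ) (x s : ℕ → ℝ) : ℕ → ℝ
  | 0 => x 0 - u₀
  | n + 1 => x (n + 1) + if s n < x (n + 1) then 0 else ageAtArrival u₀ x s n

lemma ageAtArrival_nonneg {u₀ : ℝ} (hu : u₀ ≤ 0) {x s : ℕ → ℝ} (hx : ∀ i, 0 < x i) (n : ℕ) :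
    0 ≤ ageAtArrival u₀ x s n := by
  induction n with
  | zero => simp only [ageAtArrival]; linarith [hx 0]
  | succ n ih =>
    simp only [ageAtArrival]
    have := hx (n + 1)
    split_ifs <;> linarith

/-- This ties the recursion to the supremum defining `u(t)`: a delivered update `n` is the freshest
so far and becomes the maximum; an undelivered one leaves the set unchanged. -/
lemma isGreatest_sub_ageAtArrival {u₀ : ℝ} (hu : u₀ ≤ 0) {x : ℕ → ℝ} (hx : ∀ i, 0 < x i)
    (s : ℕ → ℝ) (n : ℕ) :
    IsGreatest (insert u₀ {u : ℝ | ∃ j, j < n ∧ IsDelivered x s j ∧ u = arrivalTime x j})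
      (arrivalTime x n - ageAtArrival u₀ x s n) := by
  induction n with
  | zero => simp [ageAtArrival, arrivalTime_zero, IsGreatest, upperBounds]
  | succ n ih =>
    by_cases h : s n < x (n + 1)
    · have e : arrivalTime x (n + 1) - ageAtArrival u₀ x s (n + 1) = arrivalTime x n := by
        simp [ageAtArrival, h, arrivalTime_succ]
      rw [e]
      refine ⟨Or.inr ⟨n, n.lt_succ_self, (isDelivered_iff x s n).2 h, rfl⟩, ?_⟩
      rintro u (rfl | ⟨j, hj, -, rfl⟩)
      · exact hu.trans (arrivalTime_pos hx n).le
      · exact (strictMono_arrivalTime hx).monotone (Nat.lt_succ_iff.1 hj)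
    · have e : arrivalTime x (n + 1) - ageAtArrival u₀ x s (n + 1) =
          arrivalTime x n - ageAtArrival u₀ x s n := by
        simp only [ageAtArrival, h, arrivalTime_succ, if_false]
        ring
      rw [e]
      refine ⟨?_, ?_⟩
      · rcases ih.1 with h1 | ⟨j, hj, h1, h2⟩
        · exact Or.inl h1
        · exact Or.inr ⟨j, hj.trans n.lt_succ_self, h1, h2⟩
      · rintro u (rfl | ⟨j, hj, h1, rfl⟩)
        · exact ih.2 (Or.inl rfl)
        · rcases Nat.lt_succ_iff_lt_or_eq.1 hj with h2 | rfl
          · exact ih.2 (Or.inr ⟨j, h2, h1, rfl⟩)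
          · exact absurd ((isDelivered_iff x s j).1 h1) h

lemma age_of_lt_arrivalTime_zero (u₀ : ℝ) {x s : ℕ → ℝ} (hx : ∀ i, 0 < x i) (hs : ∀ i, 0 ≤ s i)
    {t : ℝ} (ht : t < arrivalTime x 0) : age u₀ x s t = t - u₀ := by
  unfold age lastGenerationTime
  have : {u : ℝ | ∃ n : ℕ, IsDelivered x s n ∧ arrivalTime x n + s n ≤ t ∧
      u = arrivalTime x n} = ∅ := by
    refine Set.eq_empty_of_forall_notMem ?_
    rintro u ⟨n, -, h, -⟩
    have := (strictMono_arrivalTime hx).monotone (Nat.zero_le n)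
    linarith [hs n]
  simp [this]

lemma age_eq {u₀ : ℝ} (hu : u₀ ≤ 0) {x s : ℕ → ℝ} (hx : ∀ i, 0 < x i) (hs : ∀ i, 0 ≤ s i)
    {n : ℕ} {t : ℝ} (ht : t ∈ Set.Ico (arrivalTime x n) (arrivalTime x (n + 1))) :
    age u₀ x s t =
      t - arrivalTime x n + if arrivalTime x n + s n ≤ t then 0 else ageAtArrival u₀ x s n := by
  have hmono := (strictMono_arrivalTime hx).monotone
  have hdel : arrivalTime x n + s n ≤ t → IsDelivered x s n := fun h => h.trans_lt ht.2
  -- A delivered `j < n` was completed before arrival `j + 1`, hence by time `t`; an update `j > n`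
  -- has not been generated yet. Only update `n` depends on `t`.
  have key : ∀ j, IsDelivered x s j ∧ arrivalTime x j + s j ≤ t ↔
      (j < n ∧ IsDelivered x s j) ∨ (j = n ∧ arrivalTime x n + s n ≤ t) := by
    intro j
    rcases lt_trichotomy j n with h | rfl | h
    · have := hmono (Nat.succ_le_of_lt h)
      simp only [h, h.ne, true_and, false_and, or_false, and_iff_left_iff_imp]
      intro h'
      exact (le_of_lt h').trans (this.trans ht.1)
    · simp only [lt_irrefl, false_and, true_and, false_or]
      exact ⟨And.right, fun h => ⟨hdel h, h⟩⟩
    · have := hmono (Nat.succ_le_of_lt h)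
      simp only [h.not_gt, h.ne', false_and, or_self, iff_false, not_and, not_le]
      intro _
      have := ht.2
      have := hs j
      simp only [Nat.succ_eq_add_one] at *
      linarith
  have hset : insert u₀ {u : ℝ | ∃ j : ℕ, IsDelivered x s j ∧ arrivalTime x j + s j ≤ t ∧
      u = arrivalTime x j} = {u : ℝ | u ∈ insert u₀ {u : ℝ | ∃ j, j < n ∧ IsDelivered x s j ∧
        u = arrivalTime x j} ∨ (arrivalTime x n + s n ≤ t ∧ u = arrivalTime x n)} := by
    ext u
    simp only [Set.mem_insert_iff, Set.mem_ofPred_eq, ← and_assoc, key]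
    constructor
    · rintro (h | ⟨j, h | ⟨rfl, h⟩, hu⟩)
      · exact Or.inl (Or.inl h)
      · exact Or.inl (Or.inr ⟨j, h, hu⟩)
      · exact Or.inr ⟨h, hu⟩
    · rintro ((h | ⟨j, h, hu⟩) | ⟨h, hu⟩)
      · exact Or.inl h
      · exact Or.inr ⟨j, Or.inl h, hu⟩
      · exact Or.inr ⟨n, Or.inr ⟨rfl, h⟩, hu⟩
  have hG := isGreatest_sub_ageAtArrival hu hx s n
  have hZ := ageAtArrival_nonneg (s := s) hu hx n
  unfold age lastGenerationTime
  rw [hset]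
  split_ifs with h
  · have : IsGreatest {u : ℝ | u ∈ insert u₀ {u : ℝ | ∃ j, j < n ∧ IsDelivered x s j ∧
        u = arrivalTime x j} ∨ (arrivalTime x n + s n ≤ t ∧ u = arrivalTime x n)}
        (arrivalTime x n) := by
      refine ⟨Or.inr ⟨h, rfl⟩, ?_⟩
      rintro u (h1 | ⟨-, rfl⟩)
      · linarith [hG.2 h1]
      · exact le_rfl
    rw [this.csSup_eq]; ring
  · simp only [h, false_and, or_false, Set.ofPred_mem_eq]
    rw [hG.csSup_eq]; ring

/-- The interval splits at `A + d` with `d = min (s n) (x (n + 1))`. The age is `t - A + Z` on the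
first piece and `t - A` on the second, which is empty if update `n` is preempted. Values at the
endpoints do not matter. -/
lemma intervalIntegral_age_step {u₀ : ℝ} (hu : u₀ ≤ 0) {x s : ℕ → ℝ} (hx : ∀ i, 0 < x i)
    (hs : ∀ i, 0 ≤ s i) (n : ℕ) :
    IntervalIntegrable (age u₀ x s) volume (arrivalTime x n) (arrivalTime x (n + 1)) ∧
    ∫ t in arrivalTime x n..arrivalTime x (n + 1), age u₀ x s t =
      ageAtArrival u₀ x s n * min (s n) (x (n + 1)) + x (n + 1) ^ 2 / 2 := by
  set A := arrivalTime x n with hA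
  set Z := ageAtArrival u₀ x s n
  have hA1 : arrivalTime x (n + 1) = A + x (n + 1) := arrivalTime_succ x n
  have hx1 := hx (n + 1)
  have hs1 := hs n
  set d := min (s n) (x (n + 1)) with hd
  have hd0 : 0 ≤ d := le_min hs1 hx1.le
  have hdx : d ≤ x (n + 1) := min_le_right _ _
  have e1 : Set.EqOn (fun t => t - A + Z) (age u₀ x s) (Set.uIoo A (A + d)) := by
    intro t ht
    rw [Set.uIoo_of_le (by linarith)] at ht
    have h1 : t < A + s n := ht.2.trans_le (by linarith [min_le_left (s n) (x (n + 1))])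
    rw [age_eq hu hx hs (n := n) ⟨ht.1.le, by linarith [ht.2]⟩]
    simp [← hA, h1, Z]
  have e2 : Set.EqOn (fun t => t - A) (age u₀ x s) (Set.uIoo (A + d) (A + x (n + 1))) := by
    intro t ht
    rw [Set.uIoo_of_le (by linarith)] at ht
    have h1 : A + s n ≤ t := by
      rcases min_choice (s n) (x (n + 1)) with h | h
      · rw [← hd] at h; rw [← h]; exact ht.1.le
      · rw [← hd] at h; rw [h] at ht; exact absurd (ht.1.trans ht.2) (lt_irrefl _)
    rw [age_eq hu hx hs (n := n) ⟨by linarith [ht.1], by linarith [ht.2]⟩]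
    simp [← hA, h1]
  have i1 : IntervalIntegrable (age u₀ x s) volume A (A + d) :=
    (Continuous.intervalIntegrable (by fun_prop) _ _).congr_uIoo e1
  have i2 : IntervalIntegrable (age u₀ x s) volume (A + d) (A + x (n + 1)) :=
    (Continuous.intervalIntegrable (by fun_prop) _ _).congr_uIoo e2
  rw [hA1]
  refine ⟨i1.trans i2, ?_⟩
  rw [← intervalIntegral.integral_add_adjacent_intervals i1 i2,
    ← intervalIntegral.integral_congr_uIoo e1, ← intervalIntegral.integral_congr_uIoo e2]
  simp only [sub_eq_add_neg]
  rw [intervalIntegral.integral_add (Continuous.intervalIntegrable (by fun_prop) _ _)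
    (Continuous.intervalIntegrable (by fun_prop) _ _),
    intervalIntegral.integral_add (Continuous.intervalIntegrable (by fun_prop) _ _)
    (Continuous.intervalIntegrable (by fun_prop) _ _),
    intervalIntegral.integral_add (Continuous.intervalIntegrable (by fun_prop) _ _)
    (Continuous.intervalIntegrable (by fun_prop) _ _)]
  simp only [integral_id, intervalIntegral.integral_const, smul_eq_mul]
  ring

lemma intervalIntegral_age_arrivalTime {u₀ : ℝ} (hu : u₀ ≤ 0) {x s : ℕ → ℝ} (hx : ∀ i, 0 < x i)
    (hs : ∀ i, 0 ≤ s i) (n : ℕ) :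
    IntervalIntegrable (age u₀ x s) volume 0 (arrivalTime x n) ∧
    ∫ t in (0 : ℝ)..arrivalTime x n, age u₀ x s t =
      (∫ t in (0 : ℝ)..x 0, (t - u₀)) + ∑ i ∈ Finset.range n,
        (ageAtArrival u₀ x s i * min (s i) (x (i + 1)) + x (i + 1) ^ 2 / 2) := by
  induction n with
  | zero =>
    have e : Set.EqOn (fun t => t - u₀) (age u₀ x s) (Set.uIoo 0 (x 0)) := by
      intro t ht
      rw [Set.uIoo_of_le (hx 0).le] at ht
      exact (age_of_lt_arrivalTime_zero u₀ hx hs (by rw [arrivalTime_zero]; exact ht.2)).symm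
    rw [arrivalTime_zero, ← intervalIntegral.integral_congr_uIoo e]
    exact ⟨(Continuous.intervalIntegrable (by fun_prop) _ _).congr_uIoo e, by simp⟩
  | succ n ih =>
    have h := intervalIntegral_age_step hu hx hs n
    refine ⟨ih.1.trans h.1, ?_⟩
    rw [← intervalIntegral.integral_add_adjacent_intervals ih.1 h.1, ih.2, h.2,
      Finset.sum_range_succ]
    ring

lemma age_nonneg {u₀ : ℝ} (hu : u₀ ≤ 0) {x s : ℕ → ℝ} (hs : ∀ i, 0 ≤ s i) {t : ℝ} (ht : 0 ≤ t) :
    0 ≤ age u₀ x s t := by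
  unfold age lastGenerationTime
  rw [sub_nonneg]
  refine csSup_le (Set.insert_nonempty _ _) ?_
  rintro u (rfl | ⟨n, -, h, rfl⟩)
  · exact hu.trans ht
  · linarith [hs n]

/-- The integral of a nonnegative `f` is monotone, so for `a n ≤ τ < a (n + 1)` the average at `τ`
lies between `I (a n) / a (n + 1)` and `I (a (n + 1)) / a n`. Both tend to `l / m`. -/
lemma hasTimeAverage_of_tendsto {f : ℝ → ℝ} (hf : ∀ t, 0 ≤ t → 0 ≤ f t) {a : ℕ → ℝ}
    (ha0 : ∀ n, 0 < a n) {m l : ℝ} (hm : 0 < m)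
    (ham : Tendsto (fun n : ℕ => a n / n) atTop (𝓝 m))
    (hint : ∀ n, IntervalIntegrable f volume 0 (a n))
    (hl : Tendsto (fun n : ℕ => (∫ t in (0 : ℝ)..a n, f t) / n) atTop (𝓝 l)) :
    HasTimeAverage f (l / m) := by
  have hatop : Tendsto a atTop atTop := by
    have h := ham.pos_mul_atTop hm tendsto_natCast_atTop_atTop
    refine h.congr' ?_
    filter_upwards [eventually_gt_atTop 0] with n hn
    have : (n : ℝ) ≠ 0 := by positivity
    field_simp
  have hI : ∀ τ : ℝ, 0 ≤ τ → IntervalIntegrable f volume 0 τ := by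
    intro τ hτ
    obtain ⟨n, hn⟩ := (hatop.eventually_ge_atTop τ).exists
    refine (hint n).mono_set ?_
    rw [Set.uIcc_of_le hτ, Set.uIcc_of_le (hτ.trans hn)]
    exact Set.Icc_subset_Icc_right hn
  refine ⟨hI, ?_⟩
  set I : ℝ → ℝ := fun τ => ∫ t in (0 : ℝ)..τ, f t with hIdef
  have hImono : ∀ s t : ℝ, 0 ≤ s → s ≤ t → I s ≤ I t := by
    intro s t h0 hst
    exact intervalIntegral.integral_mono_interval le_rfl h0 hst
      ((ae_restrict_mem measurableSet_Ioc).mono fun y hy => hf y hy.1.le) (hI t (h0.trans hst))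
  have hI0 : ∀ t, 0 ≤ t → 0 ≤ I t := fun t ht => by
    simpa [hIdef] using hImono 0 t le_rfl ht
  have hshift : Tendsto (fun n : ℕ => ((n + 1 : ℕ) : ℝ) / n) atTop (𝓝 1) := by
    have := (tendsto_one_div_atTop_nhds_zero_nat (𝕜 := ℝ)).const_add 1
    rw [add_zero] at this
    refine this.congr' ?_
    filter_upwards [eventually_gt_atTop 0] with n hn
    have : (n : ℝ) ≠ 0 := by positivity
    push_cast; field_simp
  have ham1 := ham.comp (tendsto_add_atTop_nat 1)
  have hl1 := hl.comp (tendsto_add_atTop_nat 1)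
  have hup : Tendsto (fun n : ℕ => I (a (n + 1)) / a n) atTop (𝓝 (l / m)) := by
    have h := (hl1.mul hshift).div ham hm.ne'
    rw [mul_one] at h
    refine h.congr' ?_
    filter_upwards [eventually_gt_atTop 0] with n hn
    have h1 : (n : ℝ) ≠ 0 := by positivity
    have h2 : ((n + 1 : ℕ) : ℝ) ≠ 0 := by positivity
    have h3 := (ha0 n).ne'
    simp only [Pi.div_apply, Function.comp, hIdef]
    field_simp
  have hlo : Tendsto (fun n : ℕ => I (a n) / a (n + 1)) atTop (𝓝 (l / m)) := by
    have h := hl.div (ham1.mul hshift) (by simpa using hm.ne')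
    rw [mul_one] at h
    refine h.congr' ?_
    filter_upwards [eventually_gt_atTop 0] with n hn
    have h1 : (n : ℝ) ≠ 0 := by positivity
    have h2 : ((n + 1 : ℕ) : ℝ) ≠ 0 := by positivity
    have h3 := (ha0 (n + 1)).ne'
    simp only [Pi.div_apply, Function.comp, hIdef]
    field_simp
  have hfind : ∀ n0 : ℕ, ∀ τ : ℝ, a n0 ≤ τ → ∃ n, n0 ≤ n ∧ a n ≤ τ ∧ τ < a (n + 1) := by
    intro n0 τ hτ
    have hex : ∃ n, n0 ≤ n ∧ τ < a (n + 1) := by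
      have := ((tendsto_add_atTop_iff_nat 1).2 hatop).eventually_gt_atTop τ
      obtain ⟨n, h1, h2⟩ := ((eventually_ge_atTop n0).and this).exists
      exact ⟨n, h1, h2⟩
    classical
    -- Since `a` is not assumed monotone, the least admissible index is taken; its minimality gives
    -- `a n ≤ τ`.
    refine ⟨Nat.find hex, (Nat.find_spec hex).1, ?_, (Nat.find_spec hex).2⟩
    by_contra! hlt
    have hne : Nat.find hex ≠ n0 := fun h => by rw [h] at hlt; linarith
    have hgt : n0 < Nat.find hex := lt_of_le_of_ne (Nat.find_spec hex).1 hne.symm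
    refine Nat.find_min hex (m := Nat.find hex - 1) (by omega) ⟨by omega, ?_⟩
    rwa [Nat.sub_add_cancel (by omega)]
  rw [tendsto_order]
  constructor
  · intro b hb
    obtain ⟨n0, hn0⟩ := eventually_atTop.1 (hlo.eventually_const_lt hb)
    filter_upwards [eventually_ge_atTop (a n0)] with τ hτ
    obtain ⟨n, hn, h1, h2⟩ := hfind n0 τ hτ
    refine (hn0 n hn).trans_le ?_
    have hτ0 : 0 < τ := (ha0 n).trans_le h1
    rw [one_div_mul_eq_div]
    exact div_le_div₀ (hI0 τ hτ0.le) (hImono _ _ (ha0 n).le h1) hτ0 h2.le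
  · intro b hb
    obtain ⟨n0, hn0⟩ := eventually_atTop.1 (hup.eventually_lt_const hb)
    filter_upwards [eventually_ge_atTop (a n0)] with τ hτ
    obtain ⟨n, hn, h1, h2⟩ := hfind n0 τ hτ
    refine lt_of_le_of_lt ?_ (hn0 n hn)
    have hτ0 : 0 < τ := (ha0 n).trans_le h1
    rw [one_div_mul_eq_div]
    exact div_le_div₀ (hI0 _ (ha0 _).le) (hImono _ _ hτ0.le h2.le) (ha0 n) h1

/-! ### Service times under infinite incremental redundancy -/

/-- If all `X i j` are independent, then so are the families `X i`. -/
lemma iIndepFun_curry {Ω ι κ 𝓧 : Type*} [MeasurableSpace Ω] [MeasurableSpace 𝓧] {P : Measure Ω}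
    {X : ι → κ → Ω → 𝓧} (mX : ∀ i j, Measurable (X i j))
    (h : iIndepFun (fun q : ι × κ => X q.1 q.2) P) : iIndepFun (fun i ω j => X i j ω) P := by
  have := h.isProbabilityMeasure
  have : ∀ i j, IsProbabilityMeasure (P.map (X i j)) :=
    fun i j => Measure.isProbabilityMeasure_map (mX i j).aemeasurable
  have h' : iIndepFun (fun (p : (_ : ι) × κ) ω => X p.1 p.2 ω) P :=
    h.precomp (g := Equiv.sigmaEquivProd ι κ) (Equiv.injective _)
  have h2 : ∀ i, iIndepFun (X i) P := fun i =>
    h.precomp (g := fun j => (i, j)) (fun _ _ hab => (Prod.mk.inj hab).2)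
  have e : (MeasurableEquiv.piCurry (fun (_ : ι) (_ : κ) => 𝓧)) ∘
      (fun ω (p : (_ : ι) × κ) => X p.1 p.2 ω) = fun ω i j => X i j ω := by
    ext; simp [Sigma.curry]
  rw [iIndepFun_iff_map_fun_eq_infinitePi_map (by fun_prop), ← e,
    ← Measure.map_map (by fun_prop) (by fun_prop), h'.map_fun_eq_infinitePi_map (by fun_prop),
    Measure.infinitePi_map_piCurry (fun i j => P.map (X i j))]
  congr 1
  funext i
  rw [(iIndepFun_iff_map_fun_eq_infinitePi_map (by fun_prop)).1 (h2 i)]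

/-- The number of unerased symbols among the first `N`. -/
def unerasedCount (N : ℕ) (e : ℕ → Bool) : ℕ :=
  ((Finset.range N).filter (fun j => e j = false)).card

lemma unerasedCount_eq_sum (N : ℕ) (e : ℕ → Bool) :
    unerasedCount N e = ∑ j ∈ Finset.range N, if e j = false then 1 else 0 := by
  rw [unerasedCount, Finset.card_filter]

lemma unerasedCount_succ (N : ℕ) (e : ℕ → Bool) :
    unerasedCount (N + 1) e = unerasedCount N e + if e N = false then 1 else 0 := by
  rw [unerasedCount_eq_sum, unerasedCount_eq_sum, Finset.sum_range_succ]

lemma unerasedCount_mono (e : ℕ → Bool) : Monotone (fun N => unerasedCount N e) :=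
  monotone_nat_of_le_succ fun N => by simp [unerasedCount_succ]

lemma measurable_unerasedCount (N : ℕ) : Measurable (unerasedCount N) := by
  have : unerasedCount N = fun e : ℕ → Bool =>
      ∑ j ∈ Finset.range N, (fun b : Bool => if b = false then 1 else 0) (e j) := by
    funext e; exact unerasedCount_eq_sum N e
  rw [this]
  exact Finset.measurable_sum _ fun j _ => (measurable_of_finite
    fun b : Bool => if b = false then 1 else 0).comp (measurable_pi_apply j)

/-- The count grows by at most one per symbol, so it first reaches `k` on an unerased symbol,
starting from `k - 1`. The value `0` is left out: for `k ≥ 1` it is the junk value `sInf ∅`, taken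
when `k` unerased symbols never arrive. -/
lemma iirServiceTime_eq_succ_iff {k : ℕ} (hk : 1 ≤ k) (e : ℕ → Bool) (m : ℕ) :
    iirServiceTime k e = m + 1 ↔ unerasedCount m e = k - 1 ∧ e m = false := by
  have hdef : iirServiceTime k e = sInf {m : ℕ | k ≤ unerasedCount m e} := rfl
  have hsucc := unerasedCount_succ m e
  rw [hdef]
  constructor
  · intro h
    have hne : {m : ℕ | k ≤ unerasedCount m e}.Nonempty := Nat.nonempty_of_sInf_eq_succ h
    have h1 : k ≤ unerasedCount (m + 1) e := by
      have := Nat.sInf_mem hne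
      rwa [h] at this
    have h2 : ¬ k ≤ unerasedCount m e :=
      Nat.notMem_of_lt_sInf (s := {m : ℕ | k ≤ unerasedCount m e}) (by omega)
    by_cases h3 : e m = false
    · simp only [h3, if_true] at hsucc
      exact ⟨by omega, h3⟩
    · rw [if_neg h3] at hsucc
      omega
  · rintro ⟨h1, h2⟩
    simp only [h2, if_true] at hsucc
    refine le_antisymm (Nat.sInf_le (by simp only [Set.mem_ofPred_eq]; omega)) ?_
    refine le_csInf ⟨m + 1, by simp only [Set.mem_ofPred_eq]; omega⟩ ?_
    intro b hb
    by_contra! hlt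
    have := unerasedCount_mono e (Nat.lt_succ_iff.1 hlt)
    simp only [Set.mem_ofPred_eq] at hb this
    omega

lemma measurable_iirServiceTime {k : ℕ} (hk : 1 ≤ k) : Measurable (iirServiceTime k) := by
  have hs : ∀ m, MeasurableSet (iirServiceTime k ⁻¹' {m + 1}) := by
    intro m
    have : iirServiceTime k ⁻¹' {m + 1} =
        unerasedCount m ⁻¹' {k - 1} ∩ (fun e : ℕ → Bool => e m) ⁻¹' {false} := by
      ext e; simp [iirServiceTime_eq_succ_iff hk]
    rw [this]
    exact (measurable_unerasedCount m (measurableSet_singleton _)).inter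
      (measurable_pi_apply m (measurableSet_singleton _))
  refine measurable_to_countable' fun m => ?_
  cases m with
  | succ m => exact hs m
  | zero =>
    have : iirServiceTime k ⁻¹' {0} = (⋃ m, iirServiceTime k ⁻¹' {m + 1})ᶜ := by
      ext e
      simp only [Set.mem_preimage, Set.mem_singleton_iff, Set.mem_compl_iff, Set.mem_iUnion,
        not_exists]
      exact ⟨fun h m => by omega, fun h => by
        cases hi : iirServiceTime k e with
        | zero => rfl
        | succ m => exact absurd hi (h m)⟩
    rw [this]
    exact (MeasurableSet.iUnion hs).compl

section

variable {Ω : Type*} [MeasurableSpace Ω]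

lemma unerasedCount_indepFun {P : Measure Ω} {e : ℕ → Ω → Bool} (he : ∀ j, Measurable (e j))
    (hind : iIndepFun e P) (N : ℕ) :
    IndepFun (fun ω => unerasedCount N (fun j => e j ω)) (e N) P := by
  have h := hind.indepFun_finset (Finset.range N) {N} (by simp) he
  have hψ : Measurable (fun v : ({N} : Finset ℕ) → Bool => v ⟨N, by simp⟩) :=
    measurable_pi_apply _
  have h2 := h.comp
    (φ := fun v : Finset.range N → Bool => ∑ j, (fun b : Bool => if b = false then 1 else 0) (v j))
    (ψ := fun v : ({N} : Finset ℕ) → Bool => v ⟨N, by simp⟩)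
    (Finset.measurable_sum _ fun j _ => (measurable_of_finite
      fun b : Bool => if b = false then 1 else 0).comp (measurable_pi_apply j))
    hψ
  convert! h2 using 1
  funext ω
  simp only [unerasedCount_eq_sum, Function.comp]
  exact (Finset.sum_coe_sort (Finset.range N) (fun j => if e j ω = false then 1 else 0)).symm

lemma measureReal_eq_false {P : Measure Ω} [IsProbabilityMeasure P] {δ : ℝ} {e : Ω → Bool}
    (he : Measurable e) (hlaw : P.real {ω | e ω = true} = δ) :
    P.real {ω | e ω = false} = 1 - δ := by
  have : {ω | e ω = false} = {ω | e ω = true}ᶜ := by ext; simp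
  have hm : MeasurableSet {ω | e ω = true} := he (measurableSet_singleton true)
  rw [this, probReal_compl_eq_one_sub hm, hlaw]

/-- Binomial law by induction on `N`: conditioning on the last symbol, which is independent of the
earlier count, gives Pascal's rule. -/
lemma measureReal_unerasedCount_eq {P : Measure Ω} [IsProbabilityMeasure P] {δ : ℝ}
    {e : ℕ → Ω → Bool} (he : ∀ j, Measurable (e j)) (hlaw : ∀ j, P.real {ω | e j ω = true} = δ)
    (hind : iIndepFun e P) (N c : ℕ) :
    P.real {ω | unerasedCount N (fun j => e j ω) = c} =
      (N.choose c : ℝ) * (1 - δ) ^ c * δ ^ (N - c) := by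
  have hm : ∀ N, Measurable (fun ω => unerasedCount N (fun j => e j ω)) := fun N =>
    (measurable_unerasedCount N).comp (measurable_pi_lambda _ he)
  have hmul : ∀ N c b, P.real {ω | unerasedCount N (fun j => e j ω) = c ∧ e N ω = b} =
      P.real {ω | unerasedCount N (fun j => e j ω) = c} * P.real {ω | e N ω = b} := by
    intro N c b
    have := (unerasedCount_indepFun he hind N).measure_inter_preimage_eq_mul {c} {b}
      (measurableSet_singleton _) (measurableSet_singleton _)
    simp only [Measure.real, ← ENNReal.toReal_mul]
    exact congrArg ENNReal.toReal this
  induction N generalizing c with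
  | zero =>
    cases c with
    | zero => simp [unerasedCount]
    | succ c => simp [unerasedCount]
  | succ N ih =>
    have hf := measureReal_eq_false (he N) (hlaw N)
    cases c with
    | zero =>
      have : {ω | unerasedCount (N + 1) (fun j => e j ω) = 0} =
          {ω | unerasedCount N (fun j => e j ω) = 0 ∧ e N ω = true} := by
        ext ω; cases h : e N ω <;> simp [unerasedCount_succ, h]
      rw [this, hmul, ih, hlaw]
      simp [pow_succ]
    | succ c =>
      have hset : {ω | unerasedCount (N + 1) (fun j => e j ω) = c + 1} =
          {ω | unerasedCount N (fun j => e j ω) = c ∧ e N ω = false} ∪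
          {ω | unerasedCount N (fun j => e j ω) = c + 1 ∧ e N ω = true} := by
        ext ω; cases h : e N ω <;> simp [unerasedCount_succ, h]
      have hdisj : Disjoint {ω | unerasedCount N (fun j => e j ω) = c ∧ e N ω = false}
          {ω | unerasedCount N (fun j => e j ω) = c + 1 ∧ e N ω = true} := by
        rw [Set.disjoint_left]
        rintro ω ⟨-, h1⟩ ⟨-, h2⟩
        simp [h1] at h2
      have hms : MeasurableSet {ω | unerasedCount N (fun j => e j ω) = c + 1 ∧ e N ω = true} :=
        ((hm N) (measurableSet_singleton (c + 1))).inter ((he N) (measurableSet_singleton true))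
      rw [hset, measureReal_union hdisj hms, hmul, hmul, ih, ih, hlaw, hf, Nat.choose_succ_succ]
      rw [show N + 1 - (c + 1) = N - c by omega]
      rcases lt_or_ge c N with h | h
      · rw [show N - c = (N - (c + 1)) + 1 by omega]
        push_cast
        ring
      · rw [Nat.choose_eq_zero_of_lt (show N < c + 1 by omega)]
        push_cast
        ring

lemma negBinomialProb_zero {k : ℕ} (hk : 1 ≤ k) (p : ℝ) : negBinomialProb k p 0 = 0 := by
  simp [negBinomialProb, show k ≠ 0 by omega]

/-- The probability generating function of the negative binomial law. -/
lemma hasSum_negBinomialProb_mul_pow {k : ℕ} (hk : 1 ≤ k) {δ z : ℝ} (hz : |δ * z| < 1) :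
    HasSum (fun m => negBinomialProb k (1 - δ) m * z ^ m)
      (((1 - δ) * z / (1 - δ * z)) ^ k) := by
  obtain ⟨j, rfl⟩ : ∃ j, k = j + 1 := ⟨k - 1, by omega⟩
  -- After the first `k = j + 1` vanishing terms are removed, what remains is the series of `(1 - δ
  -- z) ^ (-(j + 1))`, scaled by `((1 - δ) z) ^ (j + 1)`.
  have h := (hasSum_choose_mul_geometric_of_norm_lt_one j
    (show ‖δ * z‖ < 1 from hz)).mul_left (((1 - δ) * z) ^ (j + 1))
  rw [← hasSum_nat_add_iff' (j + 1)]
  have h0 : ∑ i ∈ Finset.range (j + 1), negBinomialProb (j + 1) (1 - δ) i * z ^ i = 0 :=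
    Finset.sum_eq_zero fun i hi => by
      simp [negBinomialProb, not_le.2 (Finset.mem_range.1 hi)]
  rw [h0, sub_zero]
  convert! h using 1
  · funext n
    have e1 : n + (j + 1) - 1 = n + j := by omega
    simp only [negBinomialProb, le_add_iff_nonneg_left, zero_le, if_true, e1,
      Nat.add_sub_cancel, mul_pow]
    ring
  · rw [div_pow]; ring

lemma iirServiceTime_law {P : Measure Ω} [IsProbabilityMeasure P] {k : ℕ} (hk : 1 ≤ k) {δ : ℝ}
    (hδ0 : 0 ≤ δ) (hδ1 : δ < 1) {e : ℕ → Ω → Bool} (he : ∀ j, Measurable (e j))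
    (hlaw : ∀ j, P.real {ω | e j ω = true} = δ) (hind : iIndepFun e P) (m : ℕ) :
    P.real {ω | iirServiceTime k (fun j => e j ω) = m} = negBinomialProb k (1 - δ) m := by
  have hsucc : ∀ m, P.real {ω | iirServiceTime k (fun j => e j ω) = m + 1} =
      negBinomialProb k (1 - δ) (m + 1) := by
    intro m
    have h1 := (unerasedCount_indepFun he hind m).measure_inter_preimage_eq_mul {k - 1} {false}
      (measurableSet_singleton _) (measurableSet_singleton _)
    have h2 : P.real {ω | iirServiceTime k (fun j => e j ω) = m + 1} =
        P.real {ω | unerasedCount m (fun j => e j ω) = k - 1} * P.real {ω | e m ω = false} := by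
      simp only [Measure.real, ← ENNReal.toReal_mul, iirServiceTime_eq_succ_iff hk]
      exact congrArg ENNReal.toReal h1
    rw [h2, measureReal_unerasedCount_eq he hlaw hind, measureReal_eq_false (he m) (hlaw m)]
    obtain ⟨j, rfl⟩ : ∃ j, k = j + 1 := ⟨k - 1, by omega⟩
    simp only [negBinomialProb, Nat.add_sub_cancel, add_le_add_iff_right, sub_sub_cancel,
      Nat.add_sub_add_right]
    split_ifs with h
    · ring
    · rw [Nat.choose_eq_zero_of_lt (by omega)]; simp
  cases m with
  | succ m => exact hsucc m
  | zero =>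
    have hmS : Measurable (fun ω => iirServiceTime k (fun j => e j ω)) :=
      (measurable_iirServiceTime hk).comp (measurable_pi_lambda _ he)
    -- The service time is `0` with probability zero: its law and the negative binomial weights both
    -- have total mass one (the generating function at `z = 1`), and they agree at every `m + 1`.
    have h1 : HasSum (fun m => P.real {ω | iirServiceTime k (fun j => e j ω) = m}) 1 := by
      have hd : Pairwise (Function.onFun Disjoint
          (fun m => {ω | iirServiceTime k (fun j => e j ω) = m})) := by
        intro a b hab
        rw [Function.onFun, Set.disjoint_left]
        rintro ω (h1 : _ = a) (h2 : _ = b)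
        exact hab (h1.symm.trans h2)
      have hm := fun m => hmS (measurableSet_singleton m)
      have hU : (⋃ m, {ω | iirServiceTime k (fun j => e j ω) = m}) = Set.univ := by
        ext ω; simp
      have h := measure_iUnion (μ := P) hd hm
      rw [hU, measure_univ] at h
      have h' : HasSum (fun m => P {ω | iirServiceTime k (fun j => e j ω) = m}) 1 :=
        h ▸ ENNReal.summable.hasSum
      have := (ENNReal.hasSum_toReal (f := fun m => P {ω | iirServiceTime k (fun j => e j ω) = m})
        (by rw [← h]; simp))
      rw [← ENNReal.tsum_toReal_eq (fun _ => measure_ne_top _ _), ← h,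
        ENNReal.toReal_one] at this
      exact this
    have h2 := hasSum_negBinomialProb_mul_pow hk (δ := δ) (z := 1)
      (by rw [mul_one, abs_of_nonneg hδ0]; exact hδ1)
    simp only [one_pow, mul_one, div_self (show (1 - δ) ≠ 0 by linarith)] at h2
    rw [← hasSum_nat_add_iff' 1] at h1 h2
    simp only [hsucc, Finset.range_one, Finset.sum_singleton, negBinomialProb_zero hk] at h1 h2
    have := h1.unique h2
    rw [negBinomialProb_zero hk]
    linarith

theorem isNegBinomialService_iir {P : Measure Ω} [IsProbabilityMeasure P] {k : ℕ} (hk : 1 ≤ k)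
    {δ : ℝ} (hδ0 : 0 ≤ δ) (hδ1 : δ < 1) {X : ℕ → Ω → ℝ} {E : ℕ → ℕ → Ω → Bool}
    (hE : IsErasureChannel P δ X E) :
    IsNegBinomialService P k (1 - δ) X (fun n ω => iirServiceTime k (fun j => E n j ω)) where
  measurable n := (measurable_iirServiceTime hk).comp (measurable_pi_lambda _ (hE.measurable n))
  law n m := iirServiceTime_law hk hδ0 hδ1 (hE.measurable n) (hE.law n)
    (hE.indep.precomp (g := fun j => (n, j)) (fun _ _ hab => (Prod.mk.inj hab).2)) m
  indep := (iIndepFun_curry hE.measurable hE.indep).comp (fun _ => iirServiceTime k)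
    (fun _ => measurable_iirServiceTime hk)
  indep_arrivals := hE.indep_arrivals.comp (φ := id)
    (ψ := fun (e : ℕ × ℕ → Bool) n => iirServiceTime k (fun j => e (n, j))) measurable_id
    (measurable_pi_lambda _ fun n => (measurable_iirServiceTime hk).comp
      (measurable_pi_lambda _ fun j => measurable_pi_apply (n, j)))

end

/-! ### Moments of the exponential law -/

lemma expMeasure_eq_withDensity (r : ℝ) :
    expMeasure r = (volume.restrict (Set.Ioi 0)).withDensity
      (fun x => ENNReal.ofReal (r * Real.exp (-(r * x)))) := by
  rw [← withDensity_indicator measurableSet_Ioi]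
  refine withDensity_congr_ae ?_
  have h0 : ∀ᵐ x : ℝ ∂volume, x ≠ 0 := by simp [ae_iff, measure_singleton]
  filter_upwards [h0] with x hx
  change exponentialPDF r x = _
  rw [exponentialPDF_eq]
  rcases lt_or_gt_of_ne hx with h | h
  · simp [Set.indicator, h.not_gt, h.not_ge]
  · simp [Set.indicator, h, h.le]

lemma integral_expMeasure {r : ℝ} (hr : 0 < r) (f : ℝ → ℝ) :
    ∫ x, f x ∂expMeasure r = ∫ x in Set.Ioi 0, r * Real.exp (-(r * x)) * f x := by
  rw [expMeasure_eq_withDensity, integral_withDensity_eq_integral_toReal_smul (by fun_prop) (by simp)]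
  refine integral_congr_ae (Eventually.of_forall fun x => ?_)
  simp only [smul_eq_mul]
  rw [ENNReal.toReal_ofReal (by positivity)]

lemma integrable_expMeasure_iff {r : ℝ} (hr : 0 < r) (f : ℝ → ℝ) :
    Integrable f (expMeasure r) ↔
      IntegrableOn (fun x => r * Real.exp (-(r * x)) * f x) (Set.Ioi 0) := by
  rw [expMeasure_eq_withDensity, integrable_withDensity_iff_integrable_smul' (by fun_prop) (by simp)]
  refine integrable_congr (Eventually.of_forall fun x => ?_)
  simp only [smul_eq_mul]
  rw [ENNReal.toReal_ofReal (by positivity)]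

lemma tendsto_exp_neg_mul_atTop {r : ℝ} (hr : 0 < r) :
    Tendsto (fun x : ℝ => Real.exp (-(r * x))) atTop (𝓝 0) :=
  Real.tendsto_exp_neg_atTop_nhds_zero.comp (tendsto_id.const_mul_atTop hr)

lemma tendsto_pow_mul_exp_neg_mul_atTop {r : ℝ} (hr : 0 < r) (n : ℕ) :
    Tendsto (fun x : ℝ => x ^ n * Real.exp (-(r * x))) atTop (𝓝 0) := by
  have h := ((Real.tendsto_pow_mul_exp_neg_atTop_nhds_zero n).comp
    (tendsto_id.const_mul_atTop hr)).const_mul ((r ^ n)⁻¹)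
  rw [mul_zero] at h
  refine h.congr fun x => ?_
  simp only [Function.comp, id, mul_pow]
  field_simp

lemma hasDerivAt_exp_neg_mul (r x : ℝ) :
    HasDerivAt (fun y : ℝ => Real.exp (-(r * y))) (-r * Real.exp (-(r * x))) x := by
  have := ((hasDerivAt_id' x).const_mul (-r)).exp
  simp only [neg_mul] at this
  convert! this using 1
  ring

lemma moment_two_expMeasure {r : ℝ} (hr : 0 < r) :
    Integrable (fun x : ℝ => x ^ 2) (expMeasure r) ∧ ∫ x, x ^ 2 ∂expMeasure r = 2 / r ^ 2 := by
  rw [integrable_expMeasure_iff hr, integral_expMeasure hr]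
  -- Antiderivative from two integrations by parts. As the integrand is nonnegative, the limit of
  -- `g` at infinity gives integrability as well as the value.
  set g : ℝ → ℝ := fun x => -((x ^ 2 + 2 / r * x + 2 / r ^ 2) * Real.exp (-(r * x)))
  have hg : ∀ x ∈ Set.Ici (0 : ℝ), HasDerivAt g (r * Real.exp (-(r * x)) * x ^ 2) x := by
    intro x _
    have h := ((((hasDerivAt_pow 2 x).add ((hasDerivAt_id x).const_mul (2 / r))).add_const
      (2 / r ^ 2)).mul (hasDerivAt_exp_neg_mul r x)).neg
    convert! h using 1
    simp only [id, Pi.add_apply]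
    push_cast
    field_simp
    ring
  have hlim : Tendsto g atTop (𝓝 0) := by
    have h := (((tendsto_pow_mul_exp_neg_mul_atTop hr 2).add
      ((tendsto_pow_mul_exp_neg_mul_atTop hr 1).const_mul (2 / r))).add
      ((tendsto_exp_neg_mul_atTop hr).const_mul (2 / r ^ 2))).neg
    simp only [mul_zero, add_zero, neg_zero] at h
    refine h.congr fun x => ?_
    simp only [g]; ring
  have hpos : ∀ x ∈ Set.Ioi (0 : ℝ), 0 ≤ r * Real.exp (-(r * x)) * x ^ 2 := fun x _ => by positivity
  refine ⟨integrableOn_Ioi_deriv_of_nonneg' hg hpos hlim, ?_⟩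
  rw [integral_Ioi_of_hasDerivAt_of_nonneg' hg hpos hlim]
  simp [g]

/-- Memorylessness in integrated form: the overshoot beyond `c` has mean `1 / r`, and `c` is
exceeded with probability `exp (-(r * c))`. The mean (`c = 0`) and the mean of `min c x = x - max (x
- c) 0` both come from it. -/
lemma integral_max_sub_expMeasure {r : ℝ} (hr : 0 < r) {c : ℝ} (hc : 0 ≤ c) :
    ∫ x, max (x - c) 0 ∂expMeasure r = Real.exp (-(r * c)) / r := by
  rw [integral_expMeasure hr]
  have h1 : ∫ x in Set.Ioi 0, r * Real.exp (-(r * x)) * max (x - c) 0 =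
      ∫ x in Set.Ioi c, r * Real.exp (-(r * x)) * (x - c) := by
    rw [setIntegral_eq_of_subset_of_forall_sdiff_eq_zero measurableSet_Ioi
      (Set.Ioi_subset_Ioi hc)]
    · refine setIntegral_congr_fun measurableSet_Ioi fun x hx => ?_
      simp only [Set.mem_Ioi] at hx
      simp only [max_eq_left (sub_nonneg.2 hx.le)]
    · intro x hx
      have : x ≤ c := not_lt.1 hx.2
      rw [max_eq_right (by linarith), mul_zero]
  rw [h1]
  set g : ℝ → ℝ := fun x => -((x - c + 1 / r) * Real.exp (-(r * x)))
  have hg : ∀ x ∈ Set.Ici c, HasDerivAt g (r * Real.exp (-(r * x)) * (x - c)) x := by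
    intro x _
    have h := ((((hasDerivAt_id x).sub_const c).add_const
      (1 / r)).mul (hasDerivAt_exp_neg_mul r x)).neg
    convert! h using 1
    simp only [id]
    field_simp
    ring
  have hlim : Tendsto g atTop (𝓝 0) := by
    have h := ((tendsto_pow_mul_exp_neg_mul_atTop hr 1).add
      ((tendsto_exp_neg_mul_atTop hr).const_mul (1 / r - c))).neg
    simp only [mul_zero, add_zero, neg_zero] at h
    refine h.congr fun x => ?_
    simp only [g]; ring
  have hpos : ∀ x ∈ Set.Ioi c, 0 ≤ r * Real.exp (-(r * x)) * (x - c) := fun x hx => by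
    have : 0 ≤ x - c := sub_nonneg.2 (le_of_lt hx)
    positivity
  rw [integral_Ioi_of_hasDerivAt_of_nonneg' hg hpos hlim]
  simp [g]
  ring

lemma expMeasure_real_Ioi {r : ℝ} (hr : 0 < r) {c : ℝ} (hc : 0 ≤ c) :
    (expMeasure r).real (Set.Ioi c) = Real.exp (-(r * c)) := by
  have := isProbabilityMeasure_expMeasure hr
  have h := cdf_expMeasure_eq hr c
  rw [cdf_eq_real, if_pos hc] at h
  rw [← Set.compl_Iic, probReal_compl_eq_one_sub measurableSet_Iic, h]
  ring

lemma ae_pos_expMeasure {r : ℝ} (hr : 0 < r) : ∀ᵐ x ∂expMeasure r, 0 < x := by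
  have := isProbabilityMeasure_expMeasure hr
  have h := expMeasure_real_Ioi hr le_rfl
  rw [mul_zero, neg_zero, Real.exp_zero, Measure.real, ENNReal.toReal_eq_one_iff] at h
  exact (mem_ae_iff_prob_eq_one measurableSet_Ioi).2 h

lemma integrable_id_expMeasure {r : ℝ} (hr : 0 < r) :
    Integrable (fun x : ℝ => x) (expMeasure r) := by
  have := isProbabilityMeasure_expMeasure hr
  have h : MemLp (fun x : ℝ => x) 2 (expMeasure r) :=
    (memLp_two_iff_integrable_sq measurable_id.aestronglyMeasurable).2 (moment_two_expMeasure hr).1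
  exact h.integrable one_le_two

lemma integral_id_expMeasure {r : ℝ} (hr : 0 < r) : ∫ x, x ∂expMeasure r = 1 / r := by
  have h := integral_max_sub_expMeasure hr le_rfl
  rw [mul_zero, neg_zero, Real.exp_zero] at h
  rw [← h]
  refine integral_congr_ae ?_
  filter_upwards [ae_pos_expMeasure hr] with x hx
  rw [sub_zero, max_eq_left hx.le]

lemma integral_min_expMeasure {r : ℝ} (hr : 0 < r) {c : ℝ} (hc : 0 ≤ c) :
    ∫ x, min c x ∂expMeasure r = (1 - Real.exp (-(r * c))) / r := by
  have := isProbabilityMeasure_expMeasure hr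
  have hi := integrable_id_expMeasure hr
  have e : ∀ x : ℝ, min c x = x - max (x - c) 0 := by
    intro x
    rcases le_total c x with h | h
    · rw [min_eq_left h, max_eq_left (by linarith)]; ring
    · rw [min_eq_right h, max_eq_right (by linarith)]; ring
  simp only [e]
  rw [integral_sub hi, integral_id_expMeasure hr, integral_max_sub_expMeasure hr hc]
  · ring
  · exact (hi.sub (integrable_const c)).sup (integrable_const 0)

/-! ### Joint law of an interarrival time and a service time -/

section

variable {Ω : Type*} [MeasurableSpace Ω] {P : Measure Ω} [IsProbabilityMeasure P]

/-- Fubini on the product law: the interarrival time is integrated out with the service time held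
fixed. -/
lemma integral_comp_of_indepFun {X S : Ω → ℝ} (hX : Measurable X) (hS : Measurable S)
    (h : IndepFun S X P) {f : ℝ × ℝ → ℝ} (hf : Measurable f)
    (hi : Integrable (fun ω => f (S ω, X ω)) P) :
    ∫ ω, f (S ω, X ω) ∂P = ∫ ω, ∫ x, f (S ω, x) ∂(P.map X) ∂P := by
  have : IsProbabilityMeasure (P.map X) := Measure.isProbabilityMeasure_map hX.aemeasurable
  have : IsProbabilityMeasure (P.map S) := Measure.isProbabilityMeasure_map hS.aemeasurable
  have hm := (indepFun_iff_map_prod_eq_prod_map_map hS.aemeasurable hX.aemeasurable).1 h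
  have hSX : Measurable (fun ω => (S ω, X ω)) := hS.prodMk hX
  have hi' : Integrable f ((P.map S).prod (P.map X)) := by
    rw [← hm]
    exact (integrable_map_measure hf.aestronglyMeasurable hSX.aemeasurable).2 hi
  rw [← integral_map (φ := fun ω => (S ω, X ω)) hSX.aemeasurable hf.aestronglyMeasurable, hm,
    integral_prod _ hi', integral_map hS.aemeasurable]
  exact (hf.stronglyMeasurable.integral_prod_right').aestronglyMeasurable

/-- The generating function at `z = exp (-lam)`. An exponential interarrival time exceeds an
independent service time with exactly this probability. -/
lemma integral_exp_neg_mul_negBinomial {k : ℕ} (hk : 1 ≤ k) {δ lam : ℝ} (hδ0 : 0 ≤ δ)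
    (hδ1 : δ < 1) (hlam : 0 < lam) {S : Ω → ℕ} (hS : Measurable S)
    (hlaw : ∀ m, P.real {ω | S ω = m} = negBinomialProb k (1 - δ) m) :
    ∫ ω, Real.exp (-(lam * S ω)) ∂P = ((1 - δ) / (Real.exp lam - δ)) ^ k := by
  have : IsProbabilityMeasure (P.map S) := Measure.isProbabilityMeasure_map hS.aemeasurable
  have hz : Real.exp (-lam) < 1 := by
    rw [← Real.exp_zero]; exact Real.exp_lt_exp.2 (by linarith)
  have hz0 := Real.exp_pos (-lam)
  have hi : Integrable (fun m : ℕ => Real.exp (-(lam * m))) (P.map S) := by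
    refine Integrable.of_bound (measurable_of_countable _).aestronglyMeasurable 1
      (Eventually.of_forall fun m => ?_)
    rw [Real.norm_eq_abs, abs_of_pos (Real.exp_pos _)]
    exact Real.exp_le_one_iff.2 (by simp only [Left.neg_nonpos_iff]; positivity)
  rw [← integral_map (φ := S) (f := fun m : ℕ => Real.exp (-(lam * m))) hS.aemeasurable
    (measurable_of_countable _).aestronglyMeasurable, integral_countable hi]
  have h := hasSum_negBinomialProb_mul_pow hk (δ := δ) (z := Real.exp (-lam)) (by
    rw [abs_of_nonneg (by positivity)]
    nlinarith)
  have e : ∀ m : ℕ, (P.map S).real {m} • Real.exp (-(lam * m)) =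
      negBinomialProb k (1 - δ) m * Real.exp (-lam) ^ m := by
    intro m
    rw [map_measureReal_apply hS (measurableSet_singleton m), ← hlaw m, ← Real.exp_nat_mul,
      smul_eq_mul]
    congr 2
    ring
  simp only [e]
  rw [h.tsum_eq]
  congr 1
  have := exp_sub_pos hδ1 hlam
  rw [Real.exp_neg, ← mul_div_mul_right _ _ (Real.exp_pos lam).ne', sub_mul]
  field_simp

end

/-! ### Averages of orthogonal increments -/

section Orthogonal

variable {Ω : Type*} {m0 : MeasurableSpace Ω} {P : Measure Ω}

lemma ae_tendsto_zero_of_summable_integral {f : ℕ → Ω → ℝ} (hf : ∀ i ω, 0 ≤ f i ω)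
    (hi : ∀ i, Integrable (f i) P) (hs : Summable fun i => ∫ ω, f i ω ∂P) :
    ∀ᵐ ω ∂P, Tendsto (fun i => f i ω) atTop (𝓝 0) := by
  have hm : ∀ i, AEMeasurable (fun ω => ENNReal.ofReal (f i ω)) P := fun i =>
    (hi i).aemeasurable.ennreal_ofReal
  have h1 : ∫⁻ ω, ∑' i, ENNReal.ofReal (f i ω) ∂P ≠ ⊤ := by
    rw [lintegral_tsum hm]
    have e : ∀ i, ∫⁻ ω, ENNReal.ofReal (f i ω) ∂P = ENNReal.ofReal (∫ ω, f i ω ∂P) := fun i =>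
      (ofReal_integral_eq_lintegral_ofReal (hi i) (Eventually.of_forall (hf i))).symm
    simp only [e]
    exact hs.tsum_ofReal_ne_top
  filter_upwards [ae_lt_top' (AEMeasurable.tsum hm) h1] with ω hω
  have h2 := ENNReal.tendsto_atTop_zero_of_tsum_ne_top hω.ne
  have h3 := (ENNReal.tendsto_toReal ENNReal.zero_ne_top).comp h2
  simp only [ENNReal.toReal_zero] at h3
  refine h3.congr fun i => ?_
  simp [Function.comp, ENNReal.toReal_ofReal (hf i ω)]

/-- Along `N = i ^ 2`, the second moment of `Y N / N` is at most `C / i ^ 2`, which is summable; no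
independence is needed. -/
lemma ae_tendsto_zero_of_integral_sq_le {Y : ℕ → Ω → ℝ} (hY : ∀ i, Integrable (fun ω => Y i ω ^ 2) P)
    {C : ℝ} (hC : ∀ i, ∫ ω, Y i ω ^ 2 ∂P ≤ C * i) :
    ∀ᵐ ω ∂P, Tendsto (fun i : ℕ => Y (i ^ 2) ω / (i ^ 2 : ℕ)) atTop (𝓝 0) := by
  have h := ae_tendsto_zero_of_summable_integral (P := P)
    (f := fun i ω => (Y (i ^ 2) ω / (i ^ 2 : ℕ)) ^ 2) (fun i ω => sq_nonneg _)
    (fun i => by simp only [div_pow]; exact (hY _).div_const _) ?_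
  · filter_upwards [h] with ω hω
    have h2 := hω.sqrt
    simp only [Real.sqrt_sq_eq_abs, Real.sqrt_zero] at h2
    exact tendsto_zero_iff_abs_tendsto_zero _ |>.2 h2
  · refine Summable.of_nonneg_of_le (fun i => integral_nonneg fun ω => sq_nonneg _) (fun i => ?_)
      ((Real.summable_one_div_nat_pow.2 (one_lt_two)).mul_left C)
    simp only [div_pow]
    rw [integral_div]
    rcases Nat.eq_zero_or_pos i with rfl | hi
    · simp
    · have hi' : (0 : ℝ) < i := by exact_mod_cast hi
      rw [div_le_iff₀ (by positivity)]
      refine (hC (i ^ 2)).trans (le_of_eq ?_)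
      push_cast
      field_simp

/-- `Z` is adapted to `𝓕`, and `G n` is known at time `n + 1` and independent of `𝓕 n`. -/
structure IsIndepIncrement (𝓕 : ℕ → MeasurableSpace Ω) (P : Measure Ω) (Z G : ℕ → Ω → ℝ) : Prop where
  le : ∀ n, 𝓕 n ≤ m0
  mono : Monotone 𝓕
  adapted : ∀ n, Measurable[𝓕 n] (Z n)
  adapted_succ : ∀ n, Measurable[𝓕 (n + 1)] (G n)
  indep : ∀ n, Indep (𝓕 n) (MeasurableSpace.comap (G n) inferInstance) P

namespace IsIndepIncrement

variable {𝓕 : ℕ → MeasurableSpace Ω} {Z G : ℕ → Ω → ℝ}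

lemma indepFun (h : IsIndepIncrement 𝓕 P Z G) {n : ℕ} {W : Ω → ℝ} (hW : Measurable[𝓕 n] W) :
    IndepFun W (G n) P :=
  (IndepFun_iff_Indep _ _ _).2 (indep_of_indep_of_le_left (h.indep n) hW.comap_le)

lemma measurable_left (h : IsIndepIncrement 𝓕 P Z G) (n : ℕ) : Measurable (Z n) :=
  (h.adapted n).mono (h.le n) le_rfl

lemma measurable_right (h : IsIndepIncrement 𝓕 P Z G) (n : ℕ) : Measurable (G n) :=
  (h.adapted_succ n).mono (h.le _) le_rfl

lemma memLp_mul (h : IsIndepIncrement 𝓕 P Z G) {n : ℕ} (hZ : MemLp (Z n) 2 P)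
    (hG : MemLp (G n) 2 P) :
    MemLp (fun ω => Z n ω * G n ω) 2 P ∧
      ∫ ω, (Z n ω * G n ω) ^ 2 ∂P = (∫ ω, Z n ω ^ 2 ∂P) * ∫ ω, G n ω ^ 2 ∂P := by
  have hm := (h.measurable_left n).mul (h.measurable_right n)
  have hi : IndepFun (fun ω => Z n ω ^ 2) (fun ω => G n ω ^ 2) P :=
    (h.indepFun (h.adapted n)).comp (φ := fun x => x ^ 2) (ψ := fun x => x ^ 2)
      (by fun_prop) (by fun_prop)
  have h2 := hi.integrable_mul hZ.integrable_sq hG.integrable_sq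
  refine ⟨(memLp_two_iff_integrable_sq hm.aestronglyMeasurable).2 ?_, ?_⟩
  · refine h2.congr (Eventually.of_forall fun ω => ?_)
    simp [mul_pow]
  · simp only [mul_pow]
    exact hi.integral_fun_mul_eq_mul_integral hZ.integrable_sq.aestronglyMeasurable
      hG.integrable_sq.aestronglyMeasurable

lemma measurable_sum (h : IsIndepIncrement 𝓕 P Z G) (N : ℕ) :
    Measurable[𝓕 N] (fun ω => ∑ n ∈ Finset.range N, Z n ω * G n ω) := by
  refine Finset.measurable_sum _ fun n hn => ?_
  have hn' := Finset.mem_range.1 hn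
  exact ((h.adapted n).mono (h.mono hn'.le) le_rfl).mul
    ((h.adapted_succ n).mono (h.mono hn') le_rfl)

lemma integral_sq_sum_le (h : IsIndepIncrement 𝓕 P Z G) [IsProbabilityMeasure P]
    (hZ : ∀ n, MemLp (Z n) 2 P)
    (hG : ∀ n, MemLp (G n) 2 P) (hG0 : ∀ n, ∫ ω, G n ω ∂P = 0) {B C : ℝ}
    (hGB : ∀ n, ∫ ω, G n ω ^ 2 ∂P ≤ B) (hZC : ∀ n, ∫ ω, Z n ω ^ 2 ∂P ≤ C) (N : ℕ) :
    MemLp (fun ω => ∑ n ∈ Finset.range N, Z n ω * G n ω) 2 P ∧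
      ∫ ω, (∑ n ∈ Finset.range N, Z n ω * G n ω) ^ 2 ∂P ≤ C * B * N := by
  induction N with
  | zero => simp
  | succ N ih =>
    obtain ⟨ih1, ih2⟩ := ih
    obtain ⟨hl, hsq⟩ := h.memLp_mul (hZ N) (hG N)
    simp only [Finset.sum_range_succ]
    refine ⟨ih1.add hl, ?_⟩
    have hMZ : Integrable (fun ω => (∑ n ∈ Finset.range N, Z n ω * G n ω) * Z N ω) P :=
      ih1.integrable_mul (hZ N)
    have hind : IndepFun (fun ω => (∑ n ∈ Finset.range N, Z n ω * G n ω) * Z N ω) (G N) P :=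
      h.indepFun ((h.measurable_sum N).mul (h.adapted N))
    -- The partial sum times `Z N` is known at time `N`, and `G N` is centred and independent of
    -- that past: the increments are orthogonal.
    have hcross0 : ∫ ω, (∑ n ∈ Finset.range N, Z n ω * G n ω) * Z N ω * G N ω ∂P = 0 := by
      rw [hind.integral_fun_mul_eq_mul_integral hMZ.aestronglyMeasurable
        (hG N).aestronglyMeasurable, hG0, mul_zero]
    have hcross : Integrable
        (fun ω => (∑ n ∈ Finset.range N, Z n ω * G n ω) * Z N ω * G N ω) P :=
      hind.integrable_mul hMZ ((hG N).integrable one_le_two)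
    have e : ∀ ω, (∑ n ∈ Finset.range N, Z n ω * G n ω + Z N ω * G N ω) ^ 2 =
        (∑ n ∈ Finset.range N, Z n ω * G n ω) ^ 2 +
        2 * ((∑ n ∈ Finset.range N, Z n ω * G n ω) * Z N ω * G N ω) + (Z N ω * G N ω) ^ 2 :=
      fun ω => by ring
    simp only [e]
    have hadd : Integrable (fun ω => (∑ n ∈ Finset.range N, Z n ω * G n ω) ^ 2 +
        2 * ((∑ n ∈ Finset.range N, Z n ω * G n ω) * Z N ω * G N ω)) P :=
      ih1.integrable_sq.add (hcross.const_mul 2)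
    rw [integral_add hadd hl.integrable_sq,
      integral_add ih1.integrable_sq (hcross.const_mul 2), integral_const_mul, hcross0, hsq]
    have h1 : (∫ ω, Z N ω ^ 2 ∂P) * ∫ ω, G N ω ^ 2 ∂P ≤ C * B :=
      mul_le_mul (hZC N) (hGB N) (integral_nonneg fun ω => sq_nonneg _)
        ((integral_nonneg fun ω => sq_nonneg _).trans (hZC N))
    push_cast
    linarith

lemma ae_tendsto_zero (h : IsIndepIncrement 𝓕 P Z G) [IsProbabilityMeasure P]
    (hZ : ∀ n, MemLp (Z n) 2 P)
    (hG : ∀ n, MemLp (G n) 2 P) (hG0 : ∀ n, ∫ ω, G n ω ∂P = 0) {B C : ℝ}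
    (hGB : ∀ n, ∫ ω, G n ω ^ 2 ∂P ≤ B) (hZC : ∀ n, ∫ ω, Z n ω ^ 2 ∂P ≤ C) :
    ∀ᵐ ω ∂P, Tendsto (fun i : ℕ => (∑ n ∈ Finset.range (i ^ 2), Z n ω * G n ω) / (i ^ 2 : ℕ))
      atTop (𝓝 0) :=
  ae_tendsto_zero_of_integral_sq_le
    (Y := fun N ω => ∑ n ∈ Finset.range N, Z n ω * G n ω) (C := C * B)
    (fun N => (h.integral_sq_sum_le hZ hG hG0 hGB hZC N).1.integrable_sq)
    (fun N => (h.integral_sq_sum_le hZ hG hG0 hGB hZC N).2)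

end IsIndepIncrement

end Orthogonal

/-- Consecutive squares have ratio tending to `1`, so a monotone sequence cannot stray between them.
-/
lemma tendsto_div_of_monotone_of_tendsto_sq {u : ℕ → ℝ} {l : ℝ} (hu : Monotone u)
    (h : Tendsto (fun i : ℕ => u (i ^ 2) / (i ^ 2 : ℕ)) atTop (𝓝 l)) :
    Tendsto (fun n : ℕ => u n / n) atTop (𝓝 l) := by
  refine tendsto_div_of_monotone_of_exists_subseq_tendsto_div u l hu fun a ha =>
    ⟨fun i => i ^ 2, ?_, tendsto_pow_atTop two_ne_zero, h⟩
  have h1 : Tendsto (fun n : ℕ => (1 + 1 / (n : ℝ)) ^ 2) atTop (𝓝 1) := by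
    have := ((tendsto_one_div_atTop_nhds_zero_nat (𝕜 := ℝ)).const_add 1).pow 2
    simpa using this
  filter_upwards [h1.eventually_lt_const ha, eventually_gt_atTop 0] with n hn hn0
  have hn' : (0 : ℝ) < n := by exact_mod_cast hn0
  have e : (((n + 1) ^ 2 : ℕ) : ℝ) = (1 + 1 / (n : ℝ)) ^ 2 * (n : ℝ) ^ 2 := by
    push_cast; field_simp
  rw [e]
  push_cast
  gcongr

/-! ### The average age along a sample path -/

lemma hasTimeAverage_age {u₀ : ℝ} (hu : u₀ ≤ 0) {x s : ℕ → ℝ} (hx : ∀ i, 0 < x i)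
    (hs : ∀ i, 0 ≤ s i) {μ v q w : ℝ} (hμ : 0 < μ) (hq : q < 1)
    (h1 : Tendsto (fun N : ℕ => (∑ n ∈ Finset.range N, x (n + 1)) / N) atTop (𝓝 μ))
    (h2 : Tendsto (fun N : ℕ => (∑ n ∈ Finset.range N, x (n + 1) ^ 2) / N) atTop (𝓝 v))
    (hZ : Tendsto (fun i : ℕ => ageAtArrival u₀ x s (i ^ 2) / (i ^ 2 : ℕ)) atTop (𝓝 0))
    (hq' : Tendsto (fun i : ℕ => (∑ n ∈ Finset.range (i ^ 2),
      ageAtArrival u₀ x s n * ((if s n < x (n + 1) then 0 else 1) - q)) / (i ^ 2 : ℕ)) atTop (𝓝 0))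
    (hw : Tendsto (fun i : ℕ => (∑ n ∈ Finset.range (i ^ 2),
      ageAtArrival u₀ x s n * (min (s n) (x (n + 1)) - w)) / (i ^ 2 : ℕ)) atTop (𝓝 0)) :
    HasTimeAverage (age u₀ x s) ((w * (μ / (1 - q)) + v / 2) / μ) := by
  set Z := ageAtArrival u₀ x s with hZdef
  have hZ0 : ∀ n, 0 ≤ Z n := ageAtArrival_nonneg hu hx
  have hq1 : (1 - q) ≠ 0 := by linarith
  have hsq : Tendsto (fun i : ℕ => i ^ 2) atTop atTop := tendsto_pow_atTop two_ne_zero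
  -- The recursion reads `(1 - q) Z n = x (n + 1) + (Z n - Z (n + 1)) + Z n (1{not delivered} - q)`;
  -- the middle difference telescopes.
  have hsum : ∀ N, ∑ n ∈ Finset.range N, Z n = (∑ n ∈ Finset.range N, x (n + 1) + Z 0 - Z N +
      ∑ n ∈ Finset.range N, Z n * ((if s n < x (n + 1) then 0 else 1) - q)) / (1 - q) := by
    intro N
    rw [eq_div_iff hq1]
    induction N with
    | zero => simp
    | succ N ih =>
      rw [Finset.sum_range_succ, add_mul, ih, Finset.sum_range_succ, Finset.sum_range_succ]
      have : Z (N + 1) = x (N + 1) + if s N < x (N + 1) then 0 else Z N := rfl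
      rw [this]
      split_ifs <;> ring
  have havg : Tendsto (fun i : ℕ => (∑ n ∈ Finset.range (i ^ 2), Z n) / (i ^ 2 : ℕ)) atTop
      (𝓝 (μ / (1 - q))) := by
    have hc := (tendsto_const_div_atTop_nhds_zero_nat (Z 0)).comp hsq
    have h := ((((h1.comp hsq).add hc).sub hZ).add hq').div_const (1 - q)
    rw [add_zero, sub_zero, add_zero] at h
    refine h.congr fun i => ?_
    simp only [Function.comp, hsum]
    ring
  have hZW : Tendsto (fun N : ℕ => (∑ n ∈ Finset.range N, Z n * min (s n) (x (n + 1))) / N) atTop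
      (𝓝 (w * (μ / (1 - q)))) := by
    -- The hypotheses on `Z` hold only along squares. The summands here are nonnegative, so the
    -- limit extends to all `N`.
    refine tendsto_div_of_monotone_of_tendsto_sq ?_ ?_
    · refine monotone_nat_of_le_succ fun N => ?_
      rw [Finset.sum_range_succ]
      have := mul_nonneg (hZ0 N) (le_min (hs N) (hx (N + 1)).le)
      linarith
    · have h := hw.add (havg.const_mul w)
      rw [zero_add] at h
      refine h.congr fun i => ?_
      simp only [mul_sub, Finset.sum_sub_distrib, ← Finset.sum_mul]
      ring
  have hA : Tendsto (fun n : ℕ => arrivalTime x n / n) atTop (𝓝 μ) := by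
    have h := h1.add (tendsto_const_div_atTop_nhds_zero_nat (x 0))
    rw [add_zero] at h
    refine h.congr fun n => ?_
    rw [arrivalTime, Finset.sum_range_succ', add_div]
  refine hasTimeAverage_of_tendsto (fun t ht => age_nonneg hu hs ht) (arrivalTime_pos hx) hμ hA
    (fun n => (intervalIntegral_age_arrivalTime hu hx hs n).1) ?_
  have h := (tendsto_const_div_atTop_nhds_zero_nat (∫ t in (0 : ℝ)..x 0, (t - u₀))).add
    (hZW.add (h2.div_const 2))
  rw [zero_add] at h
  refine h.congr fun n => ?_
  rw [(intervalIntegral_age_arrivalTime hu hx hs n).2, Finset.sum_add_distrib, ← Finset.sum_div]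
  ring

/-! ### Independence of past and future -/

/-- A finite cylinder over the disjoint union of the indices is an event of the `X` family
intersected with one of the `Y` family, so its probability factors first across the families, then
inside each. -/
lemma iIndepFun_sumElim {Ω ι κ 𝓧 : Type*} [MeasurableSpace Ω] [MeasurableSpace 𝓧] {P : Measure Ω}
    {X : ι → Ω → 𝓧} {Y : κ → Ω → 𝓧} (hX : iIndepFun X P) (hY : iIndepFun Y P)
    (hXY : IndepFun (fun ω i => X i ω) (fun ω j => Y j ω) P) : iIndepFun (Sum.elim X Y) P := by
  rw [iIndepFun_iff_measure_inter_preimage_eq_mul] at hX hY ⊢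
  intro T A hA
  have e : (⋂ i ∈ T, Sum.elim X Y i ⁻¹' A i) =
      (fun ω i => X i ω) ⁻¹' (⋂ i ∈ T.toLeft, (fun v => v i) ⁻¹' A (Sum.inl i)) ∩
      (fun ω j => Y j ω) ⁻¹' (⋂ j ∈ T.toRight, (fun v => v j) ⁻¹' A (Sum.inr j)) := by
    ext ω
    simp [Sum.forall]
  rw [e, hXY.measure_inter_preimage_eq_mul _ _
    (Finset.measurableSet_biInter _ fun i hi =>
      measurable_pi_apply i (hA _ (Finset.mem_toLeft.1 hi)))
    (Finset.measurableSet_biInter _ fun j hj =>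
      measurable_pi_apply j (hA _ (Finset.mem_toRight.1 hj))),
    Finset.prod_sum_eq_prod_toLeft_mul_prod_toRight]
  congr 1
  · refine Eq.trans ?_ (hX T.toLeft (sets := fun i => A (Sum.inl i))
      (fun i hi => hA _ (Finset.mem_toLeft.1 hi)))
    congr 1
    ext ω; simp
  · refine Eq.trans ?_ (hY T.toRight (sets := fun i => A (Sum.inr i))
      (fun i hi => hA _ (Finset.mem_toRight.1 hi)))
    congr 1
    ext ω; simp

section Past

/-- The indices of the interarrival times (`Sum.inl`) and service times (`Sum.inr`) that determine
the sample path before the arrival of update `n`. -/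
def pastIndices (n : ℕ) : Set (ℕ ⊕ ℕ) := {i | Sum.elim (fun j => j ≤ n) (fun j => j < n) i}

/-- The information available at the arrival of update `n`. -/
abbrev past {Ω : Type*} (X S : ℕ → Ω → ℝ) (n : ℕ) : MeasurableSpace Ω :=
  ⨆ i ∈ pastIndices n, MeasurableSpace.comap (Sum.elim X S i) inferInstance

variable {Ω : Type*} {X S : ℕ → Ω → ℝ}

lemma past_mono : Monotone (past X S) := by
  intro a b hab
  refine biSup_mono fun i hi => ?_
  rcases i with j | j
  · exact le_trans (show j ≤ a from hi) hab
  · exact lt_of_lt_of_le (show j < a from hi) hab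

lemma measurable_past_arrival (n : ℕ) : Measurable[past X S n] (X n) := by
  rw [measurable_iff_comap_le]
  exact le_iSup₂_of_le (f := fun i (_ : i ∈ pastIndices n) =>
    MeasurableSpace.comap (Sum.elim X S i) inferInstance) (Sum.inl n) (le_refl n) le_rfl

lemma measurable_past_service (n : ℕ) : Measurable[past X S (n + 1)] (S n) := by
  rw [measurable_iff_comap_le]
  exact le_iSup₂_of_le (f := fun i (_ : i ∈ pastIndices (n + 1)) =>
    MeasurableSpace.comap (Sum.elim X S i) inferInstance) (Sum.inr n) (Nat.lt_succ_self n) le_rfl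

lemma measurable_past_ageAtArrival (u₀ : ℝ) (n : ℕ) :
    Measurable[past X S n] (fun ω => ageAtArrival u₀ (fun i => X i ω) (fun i => S i ω) n) := by
  induction n with
  | zero => exact (measurable_past_arrival 0).sub_const u₀
  | succ n ih =>
    have hX := measurable_past_arrival (X := X) (S := S) (n + 1)
    have hS := measurable_past_service (X := X) (S := S) n
    exact hX.add (Measurable.ite (measurableSet_lt hS hX) measurable_const
      (ih.mono (past_mono n.le_succ) le_rfl))

variable [m0 : MeasurableSpace Ω] {P : Measure Ω}

lemma comap_sumElim_le (hX : ∀ n, Measurable (X n)) (hS : ∀ n, Measurable (S n)) (i : ℕ ⊕ ℕ) :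
    MeasurableSpace.comap (Sum.elim X S i) inferInstance ≤ m0 := by
  rcases i with j | j
  · exact (hX j).comap_le
  · exact (hS j).comap_le

lemma past_le (hX : ∀ n, Measurable (X n)) (hS : ∀ n, Measurable (S n)) (n : ℕ) :
    past X S n ≤ m0 :=
  iSup₂_le fun i _ => comap_sumElim_le hX hS i

/-- The pair `S n`, `X (n + 1)` is the first data outside `pastIndices n`, and disjoint sets of
indices generate independent σ-algebras. -/
lemma indep_past (hX : ∀ n, Measurable (X n)) (hS : ∀ n, Measurable (S n))
    (h : iIndepFun (Sum.elim X S) P) (n : ℕ) {g : ℝ × ℝ → ℝ} (hg : Measurable g) :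
    Indep (past X S n)
      (MeasurableSpace.comap (fun ω => g (S n ω, X (n + 1) ω)) inferInstance) P := by
  have hd : Disjoint (pastIndices n) {Sum.inl (n + 1), Sum.inr n} := by
    rw [Set.disjoint_left]
    rintro (j | j) hj (h | h)
    · cases h; exact absurd (show n + 1 ≤ n from hj) (by omega)
    · cases h
    · cases h
    · cases h; exact absurd (show n < n from hj) (by omega)
  have hI := indep_iSup_of_disjoint (comap_sumElim_le hX hS) h.iIndep hd
  refine indep_of_indep_of_le_right hI ?_
  rw [← measurable_iff_comap_le]
  refine hg.comp (Measurable.prodMk ?_ ?_)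
  · rw [measurable_iff_comap_le]
    exact le_iSup₂_of_le (f := fun i (_ : i ∈ ({Sum.inl (n + 1), Sum.inr n} : Set (ℕ ⊕ ℕ))) =>
      MeasurableSpace.comap (Sum.elim X S i) inferInstance) (Sum.inr n) (by simp) le_rfl
  · rw [measurable_iff_comap_le]
    exact le_iSup₂_of_le (f := fun i (_ : i ∈ ({Sum.inl (n + 1), Sum.inr n} : Set (ℕ ⊕ ℕ))) =>
      MeasurableSpace.comap (Sum.elim X S i) inferInstance) (Sum.inl (n + 1)) (by simp) le_rfl

lemma isIndepIncrement_past (hX : ∀ n, Measurable (X n)) (hS : ∀ n, Measurable (S n))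
    (h : iIndepFun (Sum.elim X S) P) (u₀ : ℝ) {g : ℝ × ℝ → ℝ} (hg : Measurable g) :
    IsIndepIncrement (past X S) P
      (fun n ω => ageAtArrival u₀ (fun i => X i ω) (fun i => S i ω) n)
      (fun n ω => g (S n ω, X (n + 1) ω)) where
  le := past_le hX hS
  mono := past_mono
  adapted := measurable_past_ageAtArrival u₀
  adapted_succ n := hg.comp ((measurable_past_service n).prodMk (measurable_past_arrival (n + 1)))
  indep n := indep_past hX hS h n hg

end Past

/-! ### Second moments of the age at arrivals -/

section

variable {Ω : Type*} [MeasurableSpace Ω] {P : Measure Ω} [IsProbabilityMeasure P]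

lemma integral_sub_sq_le {Y : Ω → ℝ} (hY : MemLp Y 2 P) {m : ℝ} (hm : ∫ ω, Y ω ∂P = m) :
    ∫ ω, (Y ω - m) ^ 2 ∂P ≤ ∫ ω, Y ω ^ 2 ∂P := by
  have h := variance_le_expectation_sq (μ := P) hY.aestronglyMeasurable
  rw [variance_eq_integral hY.aemeasurable, hm] at h
  exact h

lemma integral_sub_eq_zero {Y : Ω → ℝ} (hY : MemLp Y 2 P) {m : ℝ} (hm : ∫ ω, Y ω ∂P = m) :
    ∫ ω, (Y ω - m) ∂P = 0 := by
  rw [integral_sub (hY.integrable one_le_two) (integrable_const m), hm]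
  simp

lemma add_sq_le_of_pos {ε : ℝ} (hε : 0 < ε) (x y : ℝ) :
    (x + y) ^ 2 ≤ (1 + 1 / ε) * x ^ 2 + (1 + ε) * y ^ 2 := by
  have h : (1 + 1 / ε) * x ^ 2 + (1 + ε) * y ^ 2 - (x + y) ^ 2 = (x - ε * y) ^ 2 / ε := by
    field_simp; ring
  have : 0 ≤ (x - ε * y) ^ 2 / ε := by positivity
  linarith

/-- In `Z (n + 1) = X (n + 1) + Z n * 1{not delivered}` the indicator is independent of `Z n`, so
the last term has second moment `q * E (Z n ^ 2)` with `q < 1`. A weighted square inequality keeps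
the factor below one after `X (n + 1)` is added. -/
lemma exists_integral_ageAtArrival_sq_le {X S : ℕ → Ω → ℝ} (hX : ∀ n, Measurable (X n))
    (hS : ∀ n, Measurable (S n)) (h : iIndepFun (Sum.elim X S) P) (u₀ : ℝ)
    (hX2 : ∀ n, MemLp (X n) 2 P) {K : ℝ} (hK : ∀ n, ∫ ω, X n ω ^ 2 ∂P ≤ K) {q : ℝ} (hq : q < 1)
    (hSX : ∀ n, ∫ ω, (if S n ω < X (n + 1) ω then (0 : ℝ) else 1) ∂P = q) :
    ∃ C, ∀ n, MemLp (fun ω => ageAtArrival u₀ (fun i => X i ω) (fun i => S i ω) n) 2 P ∧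
      ∫ ω, ageAtArrival u₀ (fun i => X i ω) (fun i => S i ω) n ^ 2 ∂P ≤ C := by
  set Z := fun n ω => ageAtArrival u₀ (fun i => X i ω) (fun i => S i ω) n with hZ
  have hg : Measurable (fun p : ℝ × ℝ => if p.1 < p.2 then (0 : ℝ) else 1) :=
    Measurable.ite (measurableSet_lt measurable_fst measurable_snd) measurable_const
      measurable_const
  have hI := isIndepIncrement_past hX hS h u₀ hg
  have hG : ∀ n, MemLp (fun ω => if S n ω < X (n + 1) ω then (0 : ℝ) else 1) 2 P := fun n =>
    MemLp.of_bound (hI.measurable_right n).aestronglyMeasurable 1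
      (Eventually.of_forall fun ω => by split_ifs <;> simp)
  have hGsq : ∀ n, ∫ ω, (if S n ω < X (n + 1) ω then (0 : ℝ) else 1) ^ 2 ∂P = q := fun n => by
    rw [← hSX n]
    refine integral_congr_ae (Eventually.of_forall fun ω => ?_)
    dsimp only
    split_ifs <;> simp
  have hq0 : 0 ≤ q := hSX 0 ▸ integral_nonneg fun ω => by dsimp only; split_ifs <;> simp
  have hK0 : 0 ≤ K := (integral_nonneg fun ω => sq_nonneg _).trans (hK 0)
  have hZ0 : MemLp (Z 0) 2 P := (hX2 0).sub (memLp_const u₀)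
  -- This `ε` makes `(1 + ε) q ≤ ρ = (1 + q) / 2 < 1`; below, `c` is the fixed point of `y ↦ K' + ρ
  -- y`.
  set ε := (1 - q) / 2
  have hε : 0 < ε := by simp only [ε]; linarith
  set ρ := (1 + q) / 2
  have hρ : ρ < 1 := by simp only [ρ]; linarith
  have hερ : (1 + ε) * q ≤ ρ := by simp only [ε, ρ]; nlinarith
  set K' := (1 + 1 / ε) * K
  have hK' : 0 ≤ K' := by positivity
  set c := K' / (1 - ρ)
  have hc : 0 ≤ c := div_nonneg hK' (by linarith)
  have hc' : K' + ρ * c = c := by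
    have : (1 - ρ) ≠ 0 := by linarith
    simp only [c]; field_simp; ring
  have hE0 : 0 ≤ ∫ ω, Z 0 ω ^ 2 ∂P := integral_nonneg fun ω => sq_nonneg _
  refine ⟨(∫ ω, Z 0 ω ^ 2 ∂P) + c, fun n => ?_⟩
  induction n with
  | zero => exact ⟨hZ0, by linarith⟩
  | succ n ih =>
    obtain ⟨ih1, ih2⟩ := ih
    obtain ⟨hm, hsq⟩ := hI.memLp_mul ih1 (hG n)
    simp only at hm hsq
    rw [hGsq n] at hsq
    have e : ∀ ω, Z (n + 1) ω = X (n + 1) ω +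
        Z n ω * (if S n ω < X (n + 1) ω then (0 : ℝ) else 1) := by
      intro ω
      simp only [hZ, ageAtArrival]
      split_ifs <;> simp
    have hmem : MemLp (Z (n + 1)) 2 P := by
      rw [show Z (n + 1) = _ from funext e]
      exact (hX2 (n + 1)).add hm
    refine ⟨hmem, ?_⟩
    calc ∫ ω, Z (n + 1) ω ^ 2 ∂P
        ≤ ∫ ω, ((1 + 1 / ε) * X (n + 1) ω ^ 2 +
          (1 + ε) * (Z n ω * (if S n ω < X (n + 1) ω then (0 : ℝ) else 1)) ^ 2) ∂P :=
          integral_mono hmem.integrable_sq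
            (((hX2 (n + 1)).integrable_sq.const_mul _).add (hm.integrable_sq.const_mul _))
            fun ω => by simp only [e]; exact add_sq_le_of_pos hε _ _
      _ = (1 + 1 / ε) * (∫ ω, X (n + 1) ω ^ 2 ∂P) + (1 + ε) * ((∫ ω, Z n ω ^ 2 ∂P) * q) := by
          rw [integral_add ((hX2 (n + 1)).integrable_sq.const_mul _)
            (hm.integrable_sq.const_mul _), integral_const_mul, integral_const_mul, hsq]
      _ = (1 + 1 / ε) * (∫ ω, X (n + 1) ω ^ 2 ∂P) + ((1 + ε) * q) * (∫ ω, Z n ω ^ 2 ∂P) := by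
          ring
      _ ≤ K' + ρ * ((∫ ω, Z 0 ω ^ 2 ∂P) + c) := by
          have := hK (n + 1)
          have hn : 0 ≤ ∫ ω, Z n ω ^ 2 ∂P := integral_nonneg fun ω => sq_nonneg _
          simp only [K']
          gcongr
      _ ≤ (∫ ω, Z 0 ω ^ 2 ∂P) + c := by
          rw [mul_add, add_left_comm, hc']
          have : ρ * (∫ ω, Z 0 ω ^ 2 ∂P) ≤ 1 * ∫ ω, Z 0 ω ^ 2 ∂P := by gcongr
          linarith

end

/-! ### The average age -/

section

variable {Ω : Type*} [MeasurableSpace Ω] {P : Measure Ω} {lam : ℝ} {X : ℕ → Ω → ℝ}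

lemma IsPoissonArrivals.ae_pos (hX : IsPoissonArrivals P lam X) (hlam : 0 < lam) :
    ∀ᵐ ω ∂P, ∀ n, 0 < X n ω := by
  rw [ae_all_iff]
  intro n
  have h := ae_pos_expMeasure hlam
  rw [← hX.law n] at h
  exact ae_of_ae_map (hX.measurable n).aemeasurable h

lemma IsPoissonArrivals.integral_comp (hX : IsPoissonArrivals P lam X) (n : ℕ) {f : ℝ → ℝ}
    (hf : Measurable f) : ∫ ω, f (X n ω) ∂P = ∫ x, f x ∂expMeasure lam := by
  rw [← hX.law n, integral_map (hX.measurable n).aemeasurable hf.aestronglyMeasurable]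

lemma IsPoissonArrivals.memLp_two (hX : IsPoissonArrivals P lam X) (hlam : 0 < lam) (n : ℕ) :
    MemLp (X n) 2 P := by
  rw [memLp_two_iff_integrable_sq (hX.measurable n).aestronglyMeasurable]
  have h := (moment_two_expMeasure hlam).1
  rw [← hX.law n] at h
  exact h.comp_measurable (hX.measurable n)

lemma IsPoissonArrivals.tendsto_average (hX : IsPoissonArrivals P lam X) {f : ℝ → ℝ}
    (hf : Measurable f) (hi : ∀ n, Integrable (fun ω => f (X n ω)) P) :
    ∀ᵐ ω ∂P, Tendsto (fun N : ℕ => (∑ n ∈ Finset.range N, f (X (n + 1) ω)) / N) atTop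
      (𝓝 (∫ x, f x ∂expMeasure lam)) := by
  rw [← hX.integral_comp 1 hf]
  refine strong_law_ae_real (fun n ω => f (X (n + 1) ω)) (hi 1) ?_ fun i => ?_
  · intro i j hij
    exact (hX.indep.indepFun (show i + 1 ≠ j + 1 by omega)).comp hf hf
  · have : IdentDistrib (X (i + 1)) (X (0 + 1)) P P :=
      ⟨(hX.measurable _).aemeasurable, (hX.measurable _).aemeasurable, by
        rw [hX.law, hX.law]⟩
    exact this.comp hf

theorem ae_hasTimeAverage_age [IsProbabilityMeasure P] {k : ℕ} (hk : 1 ≤ k) {δ : ℝ} (hδ0 : 0 ≤ δ)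
    (hδ1 : δ < 1) (hlam : 0 < lam) {S : ℕ → Ω → ℕ} (hX : IsPoissonArrivals P lam X)
    (hS : IsNegBinomialService P k (1 - δ) X S) {u₀ : ℝ} (hu : u₀ ≤ 0) :
    ∀ᵐ ω ∂P, HasTimeAverage (age u₀ (fun n => X n ω) (fun n => (S n ω : ℝ))) (agePIIR k δ lam) := by
  have := isProbabilityMeasure_expMeasure hlam
  set T : ℕ → Ω → ℝ := fun n ω => (S n ω : ℝ) with hT
  have hTm : ∀ n, Measurable (T n) := fun n => measurable_from_nat.comp (hS.measurable n)
  have hind : iIndepFun (Sum.elim X T) P := by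
    refine iIndepFun_sumElim hX.indep (hS.indep.comp (fun _ (m : ℕ) => (m : ℝ))
      fun _ => measurable_from_nat) ?_
    exact hS.indep_arrivals.comp (φ := id) (ψ := fun (v : ℕ → ℕ) n => (v n : ℝ)) measurable_id
      (measurable_pi_lambda _ fun n => measurable_from_nat.comp (measurable_pi_apply n))
  have hTX : ∀ n, IndepFun (T n) (X (n + 1)) P := fun n =>
    hind.indepFun (i := Sum.inr n) (j := Sum.inl (n + 1)) (by simp)
  set φ := ((1 - δ) / (Real.exp lam - δ)) ^ k with hφ
  have hφ0 : 0 < φ := pow_pos (div_pos (by linarith) (exp_sub_pos hδ1 hlam)) k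
  have hexp : ∀ n, ∫ ω, Real.exp (-(lam * T n ω)) ∂P = φ := fun n =>
    integral_exp_neg_mul_negBinomial hk hδ0 hδ1 hlam (hS.measurable n) (hS.law n)
  have hexpi : ∀ n, Integrable (fun ω => Real.exp (-(lam * T n ω))) P := fun n => by
    refine Integrable.of_bound
      (Real.measurable_exp.comp ((hTm n).const_mul lam).neg).aestronglyMeasurable 1
      (Eventually.of_forall fun ω => ?_)
    rw [Real.norm_eq_abs, abs_of_pos (Real.exp_pos _)]
    exact Real.exp_le_one_iff.2 (by simp only [Left.neg_nonpos_iff, hT]; positivity)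
  have hga : Measurable (fun p : ℝ × ℝ => if p.1 < p.2 then (0 : ℝ) else 1) :=
    Measurable.ite (measurableSet_lt measurable_fst measurable_snd) measurable_const
      measurable_const
  have hgw : Measurable (fun p : ℝ × ℝ => min p.1 p.2) := measurable_fst.min measurable_snd
  have hX2 := hX.memLp_two hlam
  have hXsq : ∀ n, ∫ ω, X n ω ^ 2 ∂P = 2 / lam ^ 2 := fun n => by
    rw [hX.integral_comp n (f := fun x => x ^ 2) (by fun_prop), (moment_two_expMeasure hlam).2]
  have hpos := hX.ae_pos hlam
  have ha2 : ∀ n, MemLp (fun ω => if T n ω < X (n + 1) ω then (0 : ℝ) else 1) 2 P := fun n =>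
    MemLp.of_bound (hga.comp ((hTm n).prodMk (hX.measurable (n + 1)))).aestronglyMeasurable 1
      (Eventually.of_forall fun ω => by split_ifs <;> simp)
  have hw2 : ∀ n, MemLp (fun ω => min (T n ω) (X (n + 1) ω)) 2 P := fun n => by
    refine (hX2 (n + 1)).mono
      (hgw.comp ((hTm n).prodMk (hX.measurable (n + 1)))).aestronglyMeasurable ?_
    filter_upwards [hpos] with ω hω
    have h0 : 0 ≤ T n ω := Nat.cast_nonneg _
    rw [Real.norm_eq_abs, Real.norm_eq_abs, abs_of_pos (hω (n + 1)),
      abs_of_nonneg (le_min h0 (hω (n + 1)).le)]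
    exact min_le_right _ _
  have ha : ∀ n, ∫ ω, (if T n ω < X (n + 1) ω then (0 : ℝ) else 1) ∂P = 1 - φ := fun n => by
    have h := integral_comp_of_indepFun (hX.measurable (n + 1)) (hTm n) (hTX n) hga
      ((ha2 n).integrable one_le_two)
    simp only at h
    rw [h, hX.law, ← hexp n]
    have e : ∀ ω, ∫ x, (if T n ω < x then (0 : ℝ) else 1) ∂expMeasure lam =
        1 - Real.exp (-(lam * T n ω)) := by
      intro ω
      rw [← expMeasure_real_Ioi hlam (Nat.cast_nonneg (S n ω) : 0 ≤ T n ω),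
        ← probReal_compl_eq_one_sub measurableSet_Ioi,
        ← integral_indicator_one (measurableSet_Ioi.compl)]
      refine integral_congr_ae (Eventually.of_forall fun x => ?_)
      by_cases hx : (S n ω : ℝ) < x <;> simp [Set.indicator, hT, hx, not_lt.1]
    simp only [e]
    rw [integral_sub (integrable_const 1) (hexpi n)]
    simp
  have hw : ∀ n, ∫ ω, min (T n ω) (X (n + 1) ω) ∂P = (1 - φ) / lam := fun n => by
    have h := integral_comp_of_indepFun (hX.measurable (n + 1)) (hTm n) (hTX n) hgw
      ((hw2 n).integrable one_le_two)
    simp only at h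
    rw [h, hX.law, ← hexp n]
    have e : ∀ ω, ∫ x, min (T n ω) x ∂expMeasure lam =
        (1 - Real.exp (-(lam * T n ω))) / lam := fun ω =>
      integral_min_expMeasure hlam (Nat.cast_nonneg (S n ω))
    simp only [e]
    rw [integral_div, integral_sub (integrable_const 1) (hexpi n)]
    simp
  obtain ⟨C, hC⟩ := exists_integral_ageAtArrival_sq_le hX.measurable hTm hind u₀ hX2
    (fun n => (hXsq n).le) (show 1 - φ < 1 by linarith) ha
  have hC0 : 0 ≤ C := (integral_nonneg fun ω => sq_nonneg _).trans (hC 0).2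
  have hIa := (isIndepIncrement_past hX.measurable hTm hind u₀ (hga.sub_const (1 - φ))).ae_tendsto_zero
    (fun n => (hC n).1) (fun n => (ha2 n).sub (memLp_const (1 - φ)))
    (fun n => integral_sub_eq_zero (ha2 n) (ha n)) (B := 1)
    (fun n => (integral_sub_sq_le (ha2 n) (ha n)).trans (by
      have h := integral_mono (ha2 n).integrable_sq (integrable_const (1 : ℝ)) fun ω => by
        show (if T n ω < X (n + 1) ω then (0 : ℝ) else 1) ^ 2 ≤ 1
        split_ifs <;> simp
      simpa using h)) (fun n => (hC n).2)
  have hIw := (isIndepIncrement_past hX.measurable hTm hind u₀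
    (hgw.sub_const ((1 - φ) / lam))).ae_tendsto_zero
    (fun n => (hC n).1) (fun n => (hw2 n).sub (memLp_const _))
    (fun n => integral_sub_eq_zero (hw2 n) (hw n)) (B := 2 / lam ^ 2)
    (fun n => (integral_sub_sq_le (hw2 n) (hw n)).trans (by
      rw [← hXsq (n + 1)]
      refine integral_mono_ae (hw2 n).integrable_sq (hX2 (n + 1)).integrable_sq ?_
      filter_upwards [hpos] with ω hω
      have h0 : 0 ≤ T n ω := Nat.cast_nonneg _
      exact pow_le_pow_left₀ (le_min h0 (hω (n + 1)).le) (min_le_right _ _) 2))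
    (fun n => (hC n).2)
  -- A bound `C * n` is required also at `n = 0`, where `Z 0` need not vanish; setting that term to
  -- `0` is harmless, since it is divided by `0` anyway.
  have hIZ := ae_tendsto_zero_of_integral_sq_le (P := P)
    (Y := fun n ω => if n = 0 then 0 else ageAtArrival u₀ (fun i => X i ω) (fun i => T i ω) n)
    (C := C) (fun n => by
      by_cases hn : n = 0
      · simp [hn]
      · simpa [hn] using (hC n).1.integrable_sq) (fun n => by
      by_cases hn : n = 0
      · simp [hn]
      · have h1 : (1 : ℝ) ≤ n := by exact_mod_cast Nat.one_le_iff_ne_zero.2 hn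
        simp only [hn, if_false]
        exact (hC n).2.trans (le_mul_of_one_le_right hC0 h1))
  have hs1 := hX.tendsto_average (f := fun x => x) measurable_id
    fun n => (hX2 n).integrable one_le_two
  have hs2 := hX.tendsto_average (f := fun x => x ^ 2) (by fun_prop) fun n => (hX2 n).integrable_sq
  filter_upwards [hpos, hIa, hIw, hIZ, hs1, hs2] with ω hω hωa hωw hωZ hω1 hω2
  rw [integral_id_expMeasure hlam] at hω1
  rw [(moment_two_expMeasure hlam).2] at hω2
  have hωZ' : Tendsto (fun i : ℕ => ageAtArrival u₀ (fun i => X i ω) (fun i => T i ω) (i ^ 2) /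
      (i ^ 2 : ℕ)) atTop (𝓝 0) := by
    refine hωZ.congr fun i => ?_
    rcases i.eq_zero_or_pos with rfl | hi
    · simp
    · rw [if_neg (pow_pos hi 2).ne']
  -- Here `μ = 1 / lam`, `v = 2 / lam ^ 2`, `q = 1 - φ` and `w = (1 - φ) / lam`, so the limit
  -- collapses to `1 / (lam * φ)`.
  have h := hasTimeAverage_age hu hω (fun i => Nat.cast_nonneg (S i ω)) (show 0 < 1 / lam by positivity)
    (show 1 - φ < 1 by linarith) hω1 hω2 hωZ' hωa hωw
  convert! h using 1
  have e1 : agePIIR k δ lam = 1 / (lam * φ) := by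
    rw [agePIIR, hφ, ← inv_div (1 - δ), inv_pow]
    field_simp
  rw [e1, sub_sub_cancel]
  field_simp
  ring

end

end AgeOfInformation

end

theorem mainTheorem6 {Ω : Type*} [MeasurableSpace Ω] (P : Measure Ω) [IsProbabilityMeasure P]
    (k : ℕ) (hk : 1 ≤ k) (δ : ℝ) (hδ0 : 0 ≤ δ) (hδ1 : δ < 1) :
    -- under IIR on the erasure channel, the service times are i.i.d. negative binomial
    (∀ lam : ℝ, 0 < lam → ∀ (X : ℕ → Ω → ℝ) (E : ℕ → ℕ → Ω → Bool),
      AgeOfInformation.IsPoissonArrivals P lam X →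
      AgeOfInformation.IsErasureChannel P δ X E →
      AgeOfInformation.IsNegBinomialService P k (1 - δ) X
        (fun n ω => AgeOfInformation.iirServiceTime k (fun j => E n j ω))) ∧
    -- the average age
    (∀ lam : ℝ, 0 < lam → ∀ (X : ℕ → Ω → ℝ) (S : ℕ → Ω → ℕ),
      AgeOfInformation.IsPoissonArrivals P lam X →
      AgeOfInformation.IsNegBinomialService P k (1 - δ) X S →
      ∀ u₀ : ℝ, u₀ ≤ 0 → ∀ᵐ ω ∂P,
        AgeOfInformation.HasTimeAverage
          (AgeOfInformation.age u₀ (fun n => X n ω) (fun n => (S n ω : ℝ)))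
          (AgeOfInformation.agePIIR k δ lam)) ∧
    -- the minimum exists and is attained at exactly one rate
    (∃! lam : ℝ, AgeOfInformation.IsOptimalRate k δ lam) ∧
    -- the condition on the optimal rate, its equation, and the lower bound on the minimum age
    (∀ lam : ℝ, AgeOfInformation.IsOptimalRate k δ lam →
      lam ≤ 1 / (k : ℝ) ∧
      Real.exp lam * ((k : ℝ) * lam - 1) = -δ ∧
      1 / AgeOfInformation.lamIIR k δ * (1 + AgeOfInformation.lamIIR k δ / (1 - δ)) ^ k ≤
        AgeOfInformation.agePIIR k δ lam) ∧
    -- the approximation of the optimal rate: `e ^ x` is replaced by `1 + x` in its equation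
    (∀ x : ℝ, (0 < x ∧ (1 + x) * ((k : ℝ) * x - 1) = -δ) ↔
      x = AgeOfInformation.lamIIR k δ) :=
  ⟨fun _ _ _ _ _ hE => AgeOfInformation.isNegBinomialService_iir hk hδ0 hδ1 hE,
    fun _ hlam _ _ hX hS _ hu => AgeOfInformation.ae_hasTimeAverage_age hk hδ0 hδ1 hlam hX hS hu,
    AgeOfInformation.existsUnique_isOptimalRate hk hδ0 hδ1,
    fun _ h => h.bounds hk hδ0 hδ1,
    AgeOfInformation.lamIIR_iff hk hδ1⟩
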